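/- A metric graph $\Gamma$ is a finite connected multigraph (loops and parallel edges allowed) in which each edge $e$ is assigned a length $\ell_e>0$; it is identified with the topological space obtained by gluing the intervals $[0,\ell_e]$ at their end points according to the end vertices of the edges (a graph with no edges is a single point). A segment is a nondegenerate closed subinterval of the interval of an edge. A divisor on $\Gamma$ is an element $D=\sum_{p\in\Gamma}D(p)\,(p)$ of the free abelian group on the points of $\Gamma$. A rational function is a continuous function $f:\Gamma\to\mathbb{R}$ that on every edge is piecewise linear with integral slopes and finitely many linear parts; its order $\mathrm{ord}_f(p)$ at a point $p$ is the sum of the outgoing slopes of $f$ along all segments emanating from $p$, and $D_f=\sum_p \mathrm{ord}_f(p)\,(p)$. Two divisors $D,D'$ are linearly equivalent if $D=D'+D_f$ for some rational function $f$. For a closed connected set $X\subseteq\Gamma$ and $p\in\partial X$, the number of edges leaving $X$ at $p$ is the maximum size of a collection of internally disjoint segments in $\Gamma\setminus(X\setminus\{p\})$ with an end in $p$; the boundary point $p$ is saturated with respect to $D$ and $X$ if this number is at most $D(p)$, and non-saturated otherwise. For a point $v_0\in\Gamma$, a divisor $D$ is $v_0$-reduced if $D(p)\ge 0$ for all $p\ne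 v_0$ and every nonempty closed connected set $X\subseteq\Gamma$ with $v_0\notin X$ has a boundary point $p\in\partial X$ that is non-saturated with respect to $D$ and $X$. Theorem. Let $\Gamma$ be a metric graph, let $v_0$ be a point of $\Gamma$, and let $D$ be a divisor on $\Gamma$. Then there exists a unique $v_0$-reduced divisor $D_0$ on $\Gamma$ that is linearly equivalent to $D$. -/

import Mathlib

universe u v

/-- A metric graph: a connected multigraph (loops and parallel edges allowed) with vertex set `V`
and edge set `E`, each edge being assigned a positive length. Finiteness of `V` and `E` is assumed
where the structure is used. The choice of which end of an edge is its source only serves to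
parametrize the edge. -/
structure MetricGraph (V : Type u) (E : Type v) where
  /-- the end of the edge at parameter `0` -/
  src : E → V
  /-- the end of the edge at parameter `len e` -/
  tgt : E → V
  /-- the length of an edge -/
  len : E → ℝ
  len_pos : ∀ e, 0 < len e
  /-- any two vertices are joined by a walk -/
  connected : ∀ a b : V, Relation.EqvGen (fun x y => ∃ e, src e = x ∧ tgt e = y) a b

namespace MetricGraph

variable {V : Type u} {E : Type v}

/-- The points of a metric graph: the vertices, and the internal points of the edges. This is the
disjoint union of the vertices and the intervals `[0, len e]`, with the end points of the intervals
identified with the end vertices of the edges. -/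
inductive Point (Γ : MetricGraph V E) : Type (max u v)
  | vertex (w : V) : Point Γ
  | inner (e : E) (t : Set.Ioo (0 : ℝ) (Γ.len e)) : Point Γ

variable (Γ : MetricGraph V E)

/-- The parametrization of the edge `e` by the interval `[0, len e]`, extended to `ℝ` so as to be
constant to the left of `0` and to the right of `len e`. -/
noncomputable def param (e : E) (t : ℝ) : Γ.Point :=
  if h₀ : t ≤ 0 then Point.vertex (Γ.src e)
  else if h₁ : Γ.len e ≤ t then Point.vertex (Γ.tgt e)
  else Point.inner e ⟨t, lt_of_not_ge h₀, lt_of_not_ge h₁⟩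

/-- The topology of the geometric representation: the quotient topology obtained from gluing the
intervals `[0, len e]` at their ends. -/
noncomputable instance : TopologicalSpace Γ.Point :=
  ⨆ e : E, TopologicalSpace.coinduced
    (fun t : Set.Icc (0 : ℝ) (Γ.len e) => Γ.param e t) inferInstance

theorem isOpen_iff (U : Set Γ.Point) :
    IsOpen U ↔ ∀ e : E, IsOpen {t : Set.Icc (0 : ℝ) (Γ.len e) | Γ.param e t ∈ U} := by
  rw [isOpen_iSup_iff]
  rfl

/-- Divisors: the free abelian group on the points. -/
abbrev Divisor : Type (max u v) := Γ.Point →₀ ℤ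

/-- Rational functions: continuous real functions which are, on every edge, piecewise linear with
integral slopes and finitely many linear parts. Here `S` is a finite set that contains the
parameters of the internal points of `e` at which the slope changes. -/
structure IsRational (f : Γ.Point → ℝ) : Prop where
  continuous : Continuous f
  piecewise : ∀ e : E, ∃ S : Finset ℝ, ∀ a b : ℝ, 0 ≤ a → a < b → b ≤ Γ.len e →
    (∀ s ∈ S, s ∉ Set.Ioo a b) →
      ∃ m : ℤ, ∀ t ∈ Set.Icc a b, f (Γ.param e t) = f (Γ.param e a) + m * (t - a)

/-- The outgoing slope of `f` at parameter `t` of the edge `e`, in the direction of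
increasing parameters. -/
noncomputable def slopeUp (f : Γ.Point → ℝ) (e : E) (t : ℝ) : ℝ :=
  derivWithin (fun s => f (Γ.param e s)) (Set.Ici t) t

/-- The outgoing slope of `f` at parameter `t` of the edge `e`, in the direction of
decreasing parameters. -/
noncomputable def slopeDown (f : Γ.Point → ℝ) (e : E) (t : ℝ) : ℝ :=
  -derivWithin (fun s => f (Γ.param e s)) (Set.Iic t) t

open Classical in
/-- The order of `f` at a point: the sum of the outgoing slopes of `f` along all the
segments emanating from the point. A loop contributes two segments at its vertex. -/
noncomputable def ord [Fintype E] (f : Γ.Point → ℝ) : Γ.Point → ℝ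
  | Point.vertex w =>
      (∑ e : E, if Γ.src e = w then Γ.slopeUp f e 0 else 0)
        + ∑ e : E, if Γ.tgt e = w then Γ.slopeDown f e (Γ.len e) else 0
  | Point.inner e t => Γ.slopeUp f e t + Γ.slopeDown f e t

/-- Linear equivalence: `D = D' + D_f` for some rational function `f`, where `D_f` is
the divisor whose coefficient at each point `p` is the order of `f` at `p`. -/
def LinEquiv [Fintype E] (D D' : Γ.Divisor) : Prop :=
  ∃ f : Γ.Point → ℝ, Γ.IsRational f ∧ ∀ p : Γ.Point, (D p : ℝ) = (D' p : ℝ) + Γ.ord f p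

/-- A segment: a (nondegenerate) closed subinterval `[lo, hi]` of the interval of an edge. -/
structure Segment where
  edge : E
  lo : ℝ
  hi : ℝ
  lo_nonneg : 0 ≤ lo
  lo_lt_hi : lo < hi
  hi_le : hi ≤ Γ.len edge

variable {Γ}

/-- The set of points of a segment. -/
def Segment.points (s : Γ.Segment) : Set Γ.Point := Γ.param s.edge '' Set.Icc s.lo s.hi

/-- The set of internal points of a segment. -/
def Segment.interior (s : Γ.Segment) : Set Γ.Point := Γ.param s.edge '' Set.Ioo s.lo s.hi

/-- The segment has an end in `p`. -/
def Segment.HasEnd (s : Γ.Segment) (p : Γ.Point) : Prop :=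
  Γ.param s.edge s.lo = p ∨ Γ.param s.edge s.hi = p

variable (Γ)

/-- `C` is a collection of internally disjoint segments in `Γ \ (X - {p})` with an end in `p`. -/
def IsLeavingCollection (X : Set Γ.Point) (p : Γ.Point) (C : Finset Γ.Segment) : Prop :=
  (∀ s ∈ C, s.points ⊆ (X \ {p})ᶜ ∧ s.HasEnd p) ∧
    (C : Set Γ.Segment).Pairwise fun s s' => Disjoint s.interior s'.interior

/-- The number of edges leaving `X` at `p`: the maximum size of a collection of internally disjoint
segments in `Γ \ (X - {p})` with an end in `p`. The sizes are bounded by the number of edge ends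
at `p`, so the supremum is a maximum. -/
noncomputable def leaving (X : Set Γ.Point) (p : Γ.Point) : ℕ :=
  sSup {n : ℕ | ∃ C : Finset Γ.Segment, Γ.IsLeavingCollection X p C ∧ C.card = n}

/-- `p` is saturated with respect to `D` and `X`. -/
def Saturated (D : Γ.Divisor) (X : Set Γ.Point) (p : Γ.Point) : Prop :=
  (Γ.leaving X p : ℤ) ≤ D p

/-- `D` is `v₀`-reduced: it is nonnegative except possibly at `v₀`, and every (nonempty) closed
connected set avoiding `v₀` has a non-saturated boundary point. -/
def IsReduced (v₀ : Γ.Point) (D : Γ.Divisor) : Prop :=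
  (∀ p : Γ.Point, p ≠ v₀ → 0 ≤ D p) ∧
    ∀ X : Set Γ.Point, IsClosed X → IsConnected X → v₀ ∉ X →
      ∃ p ∈ frontier X, ¬ Γ.Saturated D X p

end MetricGraph

/-! Uniqueness is a maximum principle. Let D be v₀-reduced and let D + D_f be nonnegative off v₀. If
f were not maximal at v₀, take a component X of the set where f is maximal: by integrality f has
slope at most -1 in every direction leaving X, so the order of f at a boundary point is at most
minus the number of edges leaving there, and every boundary point is saturated, a contradiction
(`IsReduced.le_apply`). For two reduced divisors in one class, the function relating them and its
negative are both maximal at v₀, hence constant.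

Existence is by extremality instead of a terminating procedure. A rational function f₀ makes D +
D_{f₀} effective off v₀ (`exists_le_ord`); let D₁ be this divisor with its coefficient at v₀
replaced by 0. Among the rational h with h(v₀) = 0 and D₁ + D_h ≥ 0, a pointwise largest one yields
a reduced divisor: if all boundary points of a closed connected X avoiding v₀ were saturated, X
could be fired a small distance (`exists_firing`), adding to h a function that vanishes at v₀, is
positive on X and respects the constraint.

The difficulty is that the supremum of these h must again be rational and admissible. Adding a fixed
φ whose order is at least D₁ off a single vertex turns the h into functions of nonnegative order
inside the edges, so convex along each edge. Convexity and the lower bound on the order at vertices,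
propagated along walks, bound variation and slopes uniformly (`exists_bound`, `exists_slope_bound`).
Subgradients are then integers in a fixed finite range, so on each edge the supremum is a maximum of
finitely many integral affine functions (`exists_isPL_of_subgradients`). By integrality again, its
order at each point is at least that of some competitor (`exists_greatest`). -/

open Filter Topology Set

/-! ### One-sided slopes and piecewise linear functions of a real variable. -/

/-- The function `w` is affine with slope `m` on some interval `[0, ε]` with `ε > 0`. -/
def GermSlope (w : ℝ → ℝ) (m : ℝ) : Prop := ∀ᶠ δ in 𝓝[≥] (0 : ℝ), w δ = w 0 + m * δ

theorem eventually_nhdsGE_iff {P : ℝ → Prop} :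
    (∀ᶠ δ in 𝓝[≥] (0 : ℝ), P δ) ↔ ∃ ε > 0, ∀ δ ∈ Icc (0 : ℝ) ε, P δ := by
  rw [(nhdsGE_basis_Icc (a := (0 : ℝ))).eventually_iff]

theorem eventually_nhdsGT_iff {P : ℝ → Prop} :
    (∀ᶠ δ in 𝓝[>] (0 : ℝ), P δ) ↔ ∃ ε > 0, ∀ δ ∈ Ioc (0 : ℝ) ε, P δ := by
  rw [(nhdsGT_basis_Ioc (a := (0 : ℝ))).eventually_iff]

theorem eventually_le_nhdsGE {c : ℝ} (hc : 0 < c) : ∀ᶠ δ in 𝓝[≥] (0 : ℝ), δ ≤ c :=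
  eventually_nhdsGE_iff.2 ⟨c, hc, fun _ h => h.2⟩

theorem eventually_le_nhdsGT {c : ℝ} (hc : 0 < c) : ∀ᶠ δ in 𝓝[>] (0 : ℝ), δ ≤ c :=
  eventually_nhdsGT_iff.2 ⟨c, hc, fun _ h => h.2⟩

theorem eventually_nhdsGT_of_nhdsGE {P : ℝ → Prop} (h : ∀ᶠ δ in 𝓝[≥] (0 : ℝ), P δ) :
    ∀ᶠ δ in 𝓝[>] (0 : ℝ), P δ :=
  h.filter_mono (nhdsWithin_mono _ Ioi_subset_Ici_self)

namespace GermSlope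

variable {w v : ℝ → ℝ} {m n : ℝ}

theorem unique (h : GermSlope w m) (h' : GermSlope w n) : m = n := by
  obtain ⟨ε, hε, H⟩ := eventually_nhdsGE_iff.1 (h.and h')
  have := H ε ⟨hε.le, le_rfl⟩
  have h2 : m * ε = n * ε := by linarith [this.1, this.2]
  exact mul_right_cancel₀ hε.ne' h2

theorem add (h : GermSlope w m) (h' : GermSlope v n) : GermSlope (fun δ => w δ + v δ) (m + n) := by
  filter_upwards [h, h'] with δ h1 h2
  rw [h1, h2]; ring

theorem neg (h : GermSlope w m) : GermSlope (fun δ => -w δ) (-m) := by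
  filter_upwards [h] with δ h1
  rw [h1]; ring

theorem const (c : ℝ) : GermSlope (fun _ => c) 0 := by
  filter_upwards with δ
  ring

theorem congr (h : GermSlope w m) (hv : ∀ᶠ δ in 𝓝[≥] (0 : ℝ), v δ = w δ) : GermSlope v m := by
  have h0 := hv.self_of_nhdsWithin (by simp)
  filter_upwards [h, hv] with δ h1 h2
  rw [h2, h1, h0]

theorem tendsto (h : GermSlope w m) : Tendsto w (𝓝[≥] 0) (𝓝 (w 0)) := by
  have : Tendsto (fun δ : ℝ => w 0 + m * δ) (𝓝[≥] 0) (𝓝 (w 0 + m * 0)) :=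
    (Continuous.tendsto (by fun_prop) 0).mono_left nhdsWithin_le_nhds
  rw [mul_zero, add_zero] at this
  exact this.congr' (h.mono fun _ h => h.symm)

theorem max_of_lt (h : GermSlope w m) (h' : GermSlope v n) (hlt : v 0 < w 0) :
    GermSlope (fun δ => max (w δ) (v δ)) m := by
  refine h.congr ?_
  filter_upwards [h'.tendsto.eventually_lt h.tendsto hlt] with δ hδ
  exact max_eq_left hδ.le

theorem max_of_eq (h : GermSlope w m) (h' : GermSlope v n) (heq : v 0 = w 0) :
    GermSlope (fun δ => max (w δ) (v δ)) (max m n) := by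
  filter_upwards [h, h', self_mem_nhdsWithin] with δ h1 h2 h3
  have h3 : 0 ≤ δ := h3
  rw [h1, h2, heq, max_self, max_add_add_left, max_mul_of_nonneg _ _ h3]

theorem nonneg_of_le (h : GermSlope w m) (hle : ∀ᶠ δ in 𝓝[>] (0 : ℝ), w 0 ≤ w δ) : 0 ≤ m := by
  obtain ⟨ε, hε, H⟩ := eventually_nhdsGT_iff.1 ((eventually_nhdsGT_of_nhdsGE h).and hle)
  obtain ⟨h1, h2⟩ := H ε ⟨hε, le_rfl⟩
  have : 0 ≤ m * ε := by linarith
  exact nonneg_of_mul_nonneg_left this hε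

theorem nonpos_of_le (h : GermSlope w m) (hle : ∀ᶠ δ in 𝓝[>] (0 : ℝ), w δ ≤ w 0) : m ≤ 0 := by
  have := h.neg.nonneg_of_le (hle.mono fun δ h => neg_le_neg h)
  linarith

theorem hasDerivWithinAt (h : GermSlope w m) : HasDerivWithinAt w m (Ici 0) 0 := by
  have h1 : HasDerivWithinAt (fun δ => w 0 + m * δ) m (Ici 0) 0 := by
    simpa using ((hasDerivWithinAt_id (0 : ℝ) (Ici 0)).const_mul m).const_add (w 0)
  exact h1.congr_of_eventuallyEq h (by simp)

end GermSlope

/-- The sign of a direction along an edge. -/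
def dirSign (b : Bool) : ℝ := if b then 1 else -1

@[simp] theorem dirSign_true : dirSign true = 1 := rfl
@[simp] theorem dirSign_false : dirSign false = -1 := rfl

theorem GermSlope.hasDerivWithinAt_Ici {u : ℝ → ℝ} {t m : ℝ}
    (h : GermSlope (fun δ => u (t + δ)) m) : HasDerivWithinAt u m (Ici t) t := by
  have h1 := h.hasDerivWithinAt
  have h2 : HasDerivWithinAt (fun s => s - t) 1 (Ici t) t := by
    simpa using (hasDerivWithinAt_id t (Ici t)).sub_const t
  have h3 := HasDerivWithinAt.scomp_of_eq (h := fun s => s - t) (t' := Ici 0) t h1 h2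
    (fun x hx => by simpa using hx) (by simp)
  refine (h3.congr_deriv (by simp)).congr (fun x _ => ?_) ?_ <;> simp

theorem GermSlope.hasDerivWithinAt_Iic {u : ℝ → ℝ} {t m : ℝ}
    (h : GermSlope (fun δ => u (t - δ)) m) : HasDerivWithinAt u (-m) (Iic t) t := by
  have h1 := h.hasDerivWithinAt
  have h2 : HasDerivWithinAt (fun s => t - s) (-1) (Iic t) t := by
    simpa using (hasDerivWithinAt_id t (Iic t)).const_sub t
  have h3 := HasDerivWithinAt.scomp_of_eq (h := fun s => t - s) (t' := Ici 0) t h1 h2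
    (fun x hx => by simpa using hx) (by simp)
  refine (h3.congr_deriv (by simp)).congr (fun x _ => ?_) ?_ <;> simp

theorem GermSlope.derivWithin_Ici {u : ℝ → ℝ} {t m : ℝ} (h : GermSlope (fun δ => u (t + δ)) m) :
    derivWithin u (Ici t) t = m :=
  h.hasDerivWithinAt_Ici.derivWithin (uniqueDiffWithinAt_Ici t)

theorem GermSlope.derivWithin_Iic {u : ℝ → ℝ} {t m : ℝ} (h : GermSlope (fun δ => u (t - δ)) m) :
    derivWithin u (Iic t) t = -m :=
  h.hasDerivWithinAt_Iic.derivWithin (uniqueDiffWithinAt_Iic t)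

/-- A real function that is locally affine with integral slopes on either side of every point. -/
def IsPL (u : ℝ → ℝ) : Prop :=
  ∀ t b, ∃ m : ℤ, GermSlope (fun δ => u (t + dirSign b * δ)) m

namespace IsPL

variable {u v : ℝ → ℝ}

theorem const (c : ℝ) : IsPL fun _ => c := fun _ _ => ⟨0, by simpa using GermSlope.const c⟩

theorem affine (m : ℤ) (c : ℝ) : IsPL fun s => m * s + c := by
  intro t b
  refine ⟨if b then m else -m, ?_⟩
  filter_upwards with δ
  cases b <;> simp <;> ring

theorem add (hu : IsPL u) (hv : IsPL v) : IsPL fun s => u s + v s := by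
  intro t b
  obtain ⟨m, hm⟩ := hu t b
  obtain ⟨n, hn⟩ := hv t b
  exact ⟨m + n, by simpa using hm.add hn⟩

theorem neg (hu : IsPL u) : IsPL fun s => -u s := by
  intro t b
  obtain ⟨m, hm⟩ := hu t b
  exact ⟨-m, by simpa using hm.neg⟩

theorem max (hu : IsPL u) (hv : IsPL v) : IsPL fun s => max (u s) (v s) := by
  intro t b
  obtain ⟨m, hm⟩ := hu t b
  obtain ⟨n, hn⟩ := hv t b
  rcases lt_trichotomy (u t) (v t) with h | h | h
  · refine ⟨n, ?_⟩
    simp_rw [max_comm (u _)]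
    exact hn.max_of_lt hm (by simpa using h)
  · exact ⟨Max.max m n, by simpa using hm.max_of_eq hn (by simpa using h.symm)⟩
  · exact ⟨m, hm.max_of_lt hn (by simpa using h)⟩

theorem min (hu : IsPL u) (hv : IsPL v) : IsPL fun s => min (u s) (v s) := by
  have := (hu.neg.max hv.neg).neg
  simpa [max_neg_neg] using this

theorem sup' {ι : Type*} {S : Finset ι} (hS : S.Nonempty) {F : ι → ℝ → ℝ}
    (hF : ∀ i ∈ S, IsPL (F i)) : IsPL fun s => S.sup' hS fun i => F i s := by
  induction hS using Finset.Nonempty.cons_induction with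
  | singleton a => simpa using hF a (by simp)
  | cons a S ha hS ih =>
    simp_rw [Finset.sup'_cons hS]
    exact (hF a (by simp)).max (ih fun i hi => hF i (by simp [hi]))

theorem continuous (hu : IsPL u) : Continuous u := by
  rw [continuous_iff_continuousAt]
  intro t
  obtain ⟨m, hm⟩ := hu t true
  obtain ⟨n, hn⟩ := hu t false
  refine continuousAt_iff_continuous_left_right.2 ⟨?_, ?_⟩
  · exact (GermSlope.hasDerivWithinAt_Iic (m := n)
      (by simpa [sub_eq_add_neg] using hn)).continuousWithinAt
  · exact (GermSlope.hasDerivWithinAt_Ici (m := m) (by simpa using hm)).continuousWithinAt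

end IsPL

/-! ### Directions at a point and the unit-speed paths along them. -/

namespace MetricGraph

variable {V : Type u} {E : Type v} (Γ : MetricGraph V E)

/-- The parameter from which a direction at the given point starts. -/
def start : Γ.Point → E × Bool → ℝ
  | Point.vertex _, d => if d.2 then 0 else Γ.len d.1
  | Point.inner _ t, _ => t

/-- The path that leaves the given point in the given direction at unit speed. -/
noncomputable def path (p : Γ.Point) (d : E × Bool) (δ : ℝ) : Γ.Point :=
  Γ.param d.1 (Γ.start p d + dirSign d.2 * δ)

/-- `d` is a direction at `p`. -/
def IsDir : Γ.Point → E × Bool → Prop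
  | Point.vertex w, d => (if d.2 then Γ.src d.1 else Γ.tgt d.1) = w
  | Point.inner e _, d => d.1 = e

open Classical in
/-- The directions at a point. -/
noncomputable def dirs [Fintype E] (p : Γ.Point) : Finset (E × Bool) :=
  Finset.univ.filter (Γ.IsDir p)

@[simp] theorem mem_dirs [Fintype E] {p : Γ.Point} {d : E × Bool} :
    d ∈ Γ.dirs p ↔ Γ.IsDir p d := by
  simp [dirs]

variable {Γ}

@[simp] theorem param_zero (e : E) : Γ.param e 0 = Point.vertex (Γ.src e) := by
  simp [param]

@[simp] theorem param_len (e : E) : Γ.param e (Γ.len e) = Point.vertex (Γ.tgt e) := by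
  simp [param, not_le.2 (Γ.len_pos e)]

theorem param_inner {e : E} {t : ℝ} (ht : t ∈ Ioo 0 (Γ.len e)) :
    Γ.param e t = Point.inner e ⟨t, ht⟩ := by
  simp [param, not_le.2 ht.1, not_le.2 ht.2]

/-- Gluing identifies only ends of intervals, so an internal point has a single edge and parameter.
-/
theorem param_eq_param {e e' : E} {t t' : ℝ} (ht : t ∈ Ioo 0 (Γ.len e))
    (ht' : t' ∈ Icc 0 (Γ.len e')) (h : Γ.param e t = Γ.param e' t') : e = e' ∧ t = t' := by
  rw [param_inner ht] at h
  rcases ht'.1.eq_or_lt with rfl | h0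
  · simp at h
  rcases ht'.2.eq_or_lt with rfl | h1
  · simp at h
  rw [param_inner ⟨h0, h1⟩] at h
  injection h with h1 h2
  subst h1
  exact ⟨rfl, congrArg Subtype.val (eq_of_heq h2)⟩

theorem start_mem {p : Γ.Point} {d : E × Bool} (hd : Γ.IsDir p d) :
    Γ.start p d ∈ Icc 0 (Γ.len d.1) := by
  rcases p with w | ⟨e, t⟩
  · have := (Γ.len_pos d.1).le
    obtain ⟨e, b⟩ := d
    cases b <;> simpa [start] using this
  · have : d.1 = e := hd
    subst this
    exact ⟨t.2.1.le, t.2.2.le⟩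

theorem start_lt {p : Γ.Point} {e : E} (hd : Γ.IsDir p (e, true)) :
    Γ.start p (e, true) < Γ.len e := by
  rcases p with w | ⟨e, t⟩
  · simpa [start] using Γ.len_pos e
  · have : _ = e := hd
    subst this
    exact t.2.2

theorem start_pos {p : Γ.Point} {e : E} (hd : Γ.IsDir p (e, false)) : 0 < Γ.start p (e, false) := by
  rcases p with w | ⟨e, t⟩
  · simpa [start] using Γ.len_pos e
  · have : _ = e := hd
    subst this
    exact t.2.1

theorem param_start {p : Γ.Point} {d : E × Bool} (hd : Γ.IsDir p d) :
    Γ.param d.1 (Γ.start p d) = p := by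
  rcases p with w | ⟨e, t⟩
  · obtain ⟨e, b⟩ := d
    cases b <;> simp only [IsDir] at hd <;> simpa [start] using hd
  · have : d.1 = e := hd
    subst this
    exact param_inner t.2

theorem path_zero {p : Γ.Point} {d : E × Bool} (hd : Γ.IsDir p d) : Γ.path p d 0 = p := by
  simp [path, param_start hd]

theorem isDir_param_up {e : E} {t : ℝ} (h0 : 0 ≤ t) (h1 : t < Γ.len e) :
    Γ.IsDir (Γ.param e t) (e, true) ∧ Γ.start (Γ.param e t) (e, true) = t := by
  rcases h0.eq_or_lt with rfl | h0
  · simp [IsDir, start]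
  · simp [param_inner ⟨h0, h1⟩, IsDir, start]

theorem isDir_param_down {e : E} {t : ℝ} (h0 : 0 < t) (h1 : t ≤ Γ.len e) :
    Γ.IsDir (Γ.param e t) (e, false) ∧ Γ.start (Γ.param e t) (e, false) = t := by
  rcases h1.eq_or_lt with rfl | h1
  · simp [IsDir, start]
  · simp [param_inner ⟨h0, h1⟩, IsDir, start]

/-- The amount of space in a direction, up to the end of the edge. -/
def room (Γ : MetricGraph V E) (p : Γ.Point) (d : E × Bool) : ℝ :=
  if d.2 then Γ.len d.1 - Γ.start p d else Γ.start p d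

theorem room_pos {p : Γ.Point} {d : E × Bool} (hd : Γ.IsDir p d) : 0 < Γ.room p d := by
  obtain ⟨e, b⟩ := d
  cases b
  · simpa [room] using start_pos hd
  · simpa [room] using start_lt hd

theorem start_add_mem {p : Γ.Point} {d : E × Bool} (hd : Γ.IsDir p d) {δ : ℝ} (h0 : 0 ≤ δ)
    (h1 : δ ≤ Γ.room p d) : Γ.start p d + dirSign d.2 * δ ∈ Icc 0 (Γ.len d.1) := by
  obtain ⟨e, b⟩ := d
  have := start_mem hd
  simp only [mem_Icc] at this ⊢
  cases b <;> simp [room] at h1 ⊢ <;> constructor <;> linarith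

theorem start_add_mem_Ioo {p : Γ.Point} {d : E × Bool} (hd : Γ.IsDir p d) {δ : ℝ} (h0 : 0 < δ)
    (h1 : δ < Γ.room p d) : Γ.start p d + dirSign d.2 * δ ∈ Ioo 0 (Γ.len d.1) := by
  obtain ⟨e, b⟩ := d
  have := start_mem hd
  simp only [mem_Icc] at this
  simp only [mem_Ioo]
  cases b <;> simp [room] at h1 ⊢ <;> constructor <;> linarith

theorem continuous_param (e : E) : Continuous (Γ.param e) := by
  have h1 : Continuous fun t : Icc (0 : ℝ) (Γ.len e) => Γ.param e t := by
    rw [continuous_def]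
    intro U hU
    exact (Γ.isOpen_iff U).1 hU e
  have h2 := h1.comp (continuous_projIcc (h := (Γ.len_pos e).le))
  convert h2 using 1
  ext t
  rcases le_or_gt t 0 with h | h
  · simp [projIcc_of_le_left _ h, param, h]
  rcases le_or_gt (Γ.len e) t with h' | h'
  · simp [projIcc_of_right_le _ h', param, h', not_le.2 h, not_le.2 (Γ.len_pos e)]
  · simp [projIcc_of_mem (Γ.len_pos e).le ⟨h.le, h'.le⟩]

theorem continuous_path (p : Γ.Point) (d : E × Bool) : Continuous (Γ.path p d) :=
  (continuous_param d.1).comp (by fun_prop)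

end MetricGraph

/-! ### Finitely many pieces on an interval versus local linearity. -/

/-- `u` is piecewise affine with integral slopes and finitely many pieces on `[a, b]`. -/
def IsFinPL (u : ℝ → ℝ) (a b : ℝ) : Prop :=
  ∃ S : Finset ℝ, ∀ c d : ℝ, a ≤ c → c < d → d ≤ b → (∀ s ∈ S, s ∉ Ioo c d) →
    ∃ m : ℤ, ∀ t ∈ Icc c d, u t = u c + m * (t - c)

namespace IsFinPL

variable {u : ℝ → ℝ} {a b c : ℝ}

theorem mono (h : IsFinPL u a b) {a' b' : ℝ} (ha : a ≤ a') (hb : b' ≤ b) : IsFinPL u a' b' := by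
  obtain ⟨S, hS⟩ := h
  exact ⟨S, fun c d h1 h2 h3 h4 => hS c d (ha.trans h1) h2 (h3.trans hb) h4⟩

theorem trans (h : IsFinPL u a b) (h' : IsFinPL u b c) : IsFinPL u a c := by
  classical
  obtain ⟨S, hS⟩ := h
  obtain ⟨S', hS'⟩ := h'
  refine ⟨insert b (S ∪ S'), fun c d h1 h2 h3 h4 => ?_⟩
  have hb := h4 b (by simp)
  by_cases hd : d ≤ b
  · exact hS c d h1 h2 hd fun s hs => h4 s (by simp [hs])
  · have hc : b ≤ c := by
      by_contra hc
      exact hb ⟨not_le.1 hc, not_le.1 hd⟩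
    exact hS' c d hc h2 h3 fun s hs => h4 s (by simp [hs])

theorem of_affine {m : ℤ} {k : ℝ} (h : ∀ t ∈ Icc a b, u t = m * t + k) : IsFinPL u a b := by
  refine ⟨∅, fun c d h1 h2 h3 _ => ⟨m, fun t ht => ?_⟩⟩
  rw [h t ⟨h1.trans ht.1, ht.2.trans h3⟩, h c ⟨h1, h2.le.trans h3⟩]
  ring

end IsFinPL

/-- By compactness: each point has a neighbourhood with at most two pieces, and a finite subdivision
of the interval is subordinate to this cover. -/
theorem IsPL.isFinPL {u : ℝ → ℝ} (hu : IsPL u) {a b : ℝ} (hab : a ≤ b) : IsFinPL u a b := by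
  have key : ∀ t : ℝ, ∃ ε > 0, IsFinPL u (t - ε) (t + ε) := by
    intro t
    obtain ⟨m, hm⟩ := hu t true
    obtain ⟨n, hn⟩ := hu t false
    obtain ⟨ε, hε, H⟩ := eventually_nhdsGE_iff.1 (hm.and hn)
    refine ⟨ε, hε, IsFinPL.trans (b := t) ?_ ?_⟩
    · refine IsFinPL.of_affine (m := -n) (k := u t + n * t) fun s hs => ?_
      have := (H (t - s) ⟨by linarith [hs.2], by linarith [hs.1]⟩).2
      simp at this
      rw [this]; push_cast; ring
    · refine IsFinPL.of_affine (m := m) (k := u t - m * t) fun s hs => ?_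
      have := (H (s - t) ⟨by linarith [hs.1], by linarith [hs.2]⟩).1
      simp at this
      rw [this]; ring
  choose ε hε H using key
  obtain ⟨τ, h0, hmono, ⟨n, hn⟩, hτ⟩ := exists_monotone_Icc_subset_open_cover_Icc hab
    (c := fun t : ℝ => Subtype.val ⁻¹' Ioo (t - ε t) (t + ε t))
    (fun t => isOpen_Ioo.preimage continuous_subtype_val)
    (fun t _ => mem_iUnion.2 ⟨(t : ℝ), by simp [hε t]⟩)
  have : ∀ k, IsFinPL u a (τ k) := by
    intro k
    induction k with
    | zero => rw [h0]; exact ⟨∅, fun c d h1 h2 h3 => absurd (h1.trans_lt h2) (not_lt.2 h3)⟩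
    | succ k ih =>
      refine ih.trans ?_
      obtain ⟨i, hi⟩ := hτ k
      have hle : (τ k : ℝ) ≤ τ (k + 1) := hmono (Nat.le_succ k)
      have h1 := hi (show τ k ∈ Icc (τ k) (τ (k + 1)) from ⟨le_rfl, hle⟩)
      have h2 := hi (show τ (k + 1) ∈ Icc (τ k) (τ (k + 1)) from ⟨hle, le_rfl⟩)
      exact (H i).mono h1.1.le h2.2.le
  simpa [hn n le_rfl] using this n

theorem IsFinPL.germSlope_right {u : ℝ → ℝ} {a b : ℝ} (h : IsFinPL u a b) {t : ℝ} (h0 : a ≤ t)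
    (h1 : t < b) : ∃ m : ℤ, GermSlope (fun δ => u (t + δ)) m := by
  obtain ⟨S, hS⟩ := h
  have h2 : ∀ᶠ d in 𝓝[>] t, ∀ s ∈ S, s ∉ Ioo t d := by
    rw [Filter.eventually_all_finset]
    intro s _
    rcases le_or_gt s t with hs | hs
    · exact Eventually.of_forall fun d hd => absurd hd.1 (not_lt.2 hs)
    · filter_upwards [Ioo_mem_nhdsGT hs] with d hd hd'
      exact absurd hd.2 (not_lt.2 hd'.2.le)
  obtain ⟨d, h3, h4⟩ := (h2.and (Ioo_mem_nhdsGT h1)).exists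
  obtain ⟨m, hm⟩ := hS t d h0 h4.1 h4.2.le h3
  refine ⟨m, ?_⟩
  filter_upwards [eventually_le_nhdsGE (sub_pos.2 h4.1), self_mem_nhdsWithin] with δ hδ hδ'
  have hδ' : 0 ≤ δ := hδ'
  rw [hm _ ⟨by linarith, by linarith⟩]
  simp

theorem IsFinPL.germSlope_left {u : ℝ → ℝ} {a b : ℝ} (h : IsFinPL u a b) {t : ℝ} (h0 : a < t)
    (h1 : t ≤ b) : ∃ m : ℤ, GermSlope (fun δ => u (t - δ)) m := by
  obtain ⟨S, hS⟩ := h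
  have h2 : ∀ᶠ d in 𝓝[<] t, ∀ s ∈ S, s ∉ Ioo d t := by
    rw [Filter.eventually_all_finset]
    intro s _
    rcases le_or_gt t s with hs | hs
    · exact Eventually.of_forall fun d hd => absurd hd.2 (not_lt.2 hs)
    · filter_upwards [Ioo_mem_nhdsLT hs] with d hd hd'
      exact absurd hd.1 (not_lt.2 hd'.1.le)
  obtain ⟨d, h3, h4⟩ := (h2.and (Ioo_mem_nhdsLT h0)).exists
  obtain ⟨m, hm⟩ := hS d t h4.1.le h4.2 h1 h3
  refine ⟨-m, ?_⟩
  filter_upwards [eventually_le_nhdsGE (sub_pos.2 h4.2), self_mem_nhdsWithin] with δ hδ hδ'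
  have hδ' : 0 ≤ δ := hδ'
  rw [hm _ ⟨by linarith, by linarith⟩, sub_zero, hm t ⟨h4.2.le, le_rfl⟩]
  push_cast; ring

/-! ### Rational functions and their orders. -/

namespace MetricGraph

variable {V : Type u} {E : Type v} {Γ : MetricGraph V E}

theorem isDir_cases {p : Γ.Point} {d : E × Bool} (hd : Γ.IsDir p d) :
    (d.2 = true ∧ 0 ≤ Γ.start p d ∧ Γ.start p d < Γ.len d.1) ∨
      (d.2 = false ∧ 0 < Γ.start p d ∧ Γ.start p d ≤ Γ.len d.1) := by
  obtain ⟨e, b⟩ := d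
  cases b
  · exact Or.inr ⟨rfl, start_pos hd, (start_mem hd).2⟩
  · exact Or.inl ⟨rfl, (start_mem hd).1, start_lt hd⟩

theorem IsRational.exists_germSlope {f : Γ.Point → ℝ} (hf : Γ.IsRational f) {p : Γ.Point}
    {d : E × Bool} (hd : Γ.IsDir p d) : ∃ m : ℤ, GermSlope (fun δ => f (Γ.path p d δ)) m := by
  have h : IsFinPL (fun t => f (Γ.param d.1 t)) 0 (Γ.len d.1) := hf.piecewise d.1
  unfold path
  rcases isDir_cases hd with ⟨h1, h2, h3⟩ | ⟨h1, h2, h3⟩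
  · simpa [h1] using h.germSlope_right h2 h3
  · simpa [h1, sub_eq_add_neg] using h.germSlope_left h2 h3

/-- The slope of a rational function in a direction at a point. -/
noncomputable def slope (Γ : MetricGraph V E) (f : Γ.Point → ℝ) (p : Γ.Point) (d : E × Bool) : ℤ :=
  open Classical in
  if h : ∃ m : ℤ, GermSlope (fun δ => f (Γ.path p d δ)) m then h.choose else 0

theorem IsRational.germSlope {f : Γ.Point → ℝ} (hf : Γ.IsRational f) {p : Γ.Point}
    {d : E × Bool} (hd : Γ.IsDir p d) : GermSlope (fun δ => f (Γ.path p d δ)) (Γ.slope f p d) := by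
  have h := hf.exists_germSlope hd
  rw [slope, dif_pos h]
  exact h.choose_spec

/-- Replaces the one-sided derivatives in `ord` by one sum over directions, valid at vertices and
internal points alike; a loop gives two directions at its vertex. -/
theorem ord_eq_sum_of_germSlope [Fintype E] {f : Γ.Point → ℝ} {p : Γ.Point} {m : E × Bool → ℝ}
    (h : ∀ d, Γ.IsDir p d → GermSlope (fun δ => f (Γ.path p d δ)) (m d)) :
    Γ.ord f p = ∑ d ∈ Γ.dirs p, m d := by
  classical
  rcases p with w | ⟨e, t⟩
  · rw [ord, dirs, Finset.sum_filter, Fintype.sum_prod_type, ← Finset.sum_add_distrib]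
    refine Finset.sum_congr rfl fun e _ => ?_
    rw [Fintype.sum_bool]
    congr 1
    · have h1 : Γ.IsDir (Point.vertex w) (e, true) ↔ Γ.src e = w := Iff.rfl
      simp only [h1]
      split_ifs with hw
      · exact GermSlope.derivWithin_Ici (u := fun s => f (Γ.param e s)) (t := 0)
          (by simpa [path, start] using h (e, true) hw)
      · rfl
    · have h1 : Γ.IsDir (Point.vertex w) (e, false) ↔ Γ.tgt e = w := by simp [IsDir]
      simp only [h1]
      split_ifs with hw
      · have := GermSlope.derivWithin_Iic (u := fun s => f (Γ.param e s)) (t := Γ.len e)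
          (by simpa [path, start, sub_eq_add_neg] using h (e, false) (h1.2 hw))
        rw [slopeDown, this, neg_neg]
      · rfl
  · have h1 : Γ.dirs (Point.inner e t) = {(e, true), (e, false)} := by
      ext ⟨e', b⟩
      cases b <;> simp [IsDir]
    rw [h1, Finset.sum_pair (by simp), ord]
    congr 1
    · exact GermSlope.derivWithin_Ici (u := fun s => f (Γ.param e s)) (t := t)
          (by simpa [path, start] using h (e, true) rfl)
    · have := GermSlope.derivWithin_Iic (u := fun s => f (Γ.param e s)) (t := t)
          (by simpa [path, start, sub_eq_add_neg] using h (e, false) rfl)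
      rw [slopeDown, this, neg_neg]

theorem IsRational.ord_eq [Fintype E] {f : Γ.Point → ℝ} (hf : Γ.IsRational f) (p : Γ.Point) :
    Γ.ord f p = ((∑ d ∈ Γ.dirs p, Γ.slope f p d : ℤ) : ℝ) := by
  rw [ord_eq_sum_of_germSlope fun d hd => hf.germSlope hd]
  push_cast; rfl

theorem isRational_of_edges {f : Γ.Point → ℝ}
    (h : ∀ e, ∃ u, IsPL u ∧ ∀ t ∈ Icc 0 (Γ.len e), f (Γ.param e t) = u t) : Γ.IsRational f := by
  choose u hu hfu using h
  constructor
  · rw [continuous_def]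
    intro U hU
    rw [isOpen_iff]
    intro e
    have : Continuous fun t : Icc (0 : ℝ) (Γ.len e) => u e t :=
      (hu e).continuous.comp continuous_subtype_val
    convert hU.preimage this using 1
    ext t
    simp [hfu e t t.2]
  · intro e
    obtain ⟨S, hS⟩ := (hu e).isFinPL (Γ.len_pos e).le
    refine ⟨S, fun a b h1 h2 h3 h4 => ?_⟩
    obtain ⟨m, hm⟩ := hS a b h1 h2 h3 h4
    refine ⟨m, fun t ht => ?_⟩
    rw [hfu e t ⟨h1.trans ht.1, ht.2.trans h3⟩, hfu e a ⟨h1, h2.le.trans h3⟩, hm t ht]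

theorem param_of_le_zero {e : E} {t : ℝ} (h : t ≤ 0) : Γ.param e t = Γ.param e 0 := by
  simp [param, h]

theorem param_of_len_le {e : E} {t : ℝ} (h : Γ.len e ≤ t) :
    Γ.param e t = Γ.param e (Γ.len e) := by
  simp [param, h, not_le.2 ((Γ.len_pos e).trans_le h), not_le.2 (Γ.len_pos e)]

/-- Holds on all of ℝ because `param` is constant beyond both ends of the edge. This removes
end-point cases from sums and maxima. -/
theorem IsRational.isPL {f : Γ.Point → ℝ} (hf : Γ.IsRational f) (e : E) :
    IsPL fun t => f (Γ.param e t) := by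
  have h : IsFinPL (fun t => f (Γ.param e t)) 0 (Γ.len e) := hf.piecewise e
  intro t b
  cases b
  · simp only [dirSign_false, neg_one_mul, ← sub_eq_add_neg]
    rcases le_or_gt t 0 with h0 | h0
    · refine ⟨0, ?_⟩
      filter_upwards [self_mem_nhdsWithin] with δ hδ
      have hδ : 0 ≤ δ := hδ
      rw [param_of_le_zero (by linarith), sub_zero, param_of_le_zero h0]
      simp
    rcases le_or_gt t (Γ.len e) with h1 | h1
    · exact h.germSlope_left h0 h1
    · refine ⟨0, ?_⟩
      filter_upwards [eventually_le_nhdsGE (sub_pos.2 h1)] with δ hδ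
      rw [param_of_len_le (by linarith), sub_zero, param_of_len_le h1.le]
      simp
  · simp only [dirSign_true, one_mul]
    rcases le_or_gt (Γ.len e) t with h0 | h0
    · refine ⟨0, ?_⟩
      filter_upwards [self_mem_nhdsWithin] with δ hδ
      have hδ : 0 ≤ δ := hδ
      rw [param_of_len_le (by linarith), add_zero, param_of_len_le h0]
      simp
    rcases le_or_gt 0 t with h1 | h1
    · exact h.germSlope_right h1 h0
    · refine ⟨0, ?_⟩
      filter_upwards [eventually_le_nhdsGE (neg_pos.2 h1)] with δ hδ
      rw [param_of_le_zero (by linarith), add_zero, param_of_le_zero h1.le]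
      simp

theorem isRational_of_isPL {f : Γ.Point → ℝ} (h : ∀ e, IsPL fun t => f (Γ.param e t)) :
    Γ.IsRational f :=
  isRational_of_edges fun e => ⟨_, h e, fun _ _ => rfl⟩

theorem ord_param_of_germSlope [Fintype E] {f : Γ.Point → ℝ} {e : E} {t : ℝ}
    (ht : t ∈ Ioo 0 (Γ.len e)) {m n : ℝ}
    (hm : GermSlope (fun δ => f (Γ.param e (t + δ))) m)
    (hn : GermSlope (fun δ => f (Γ.param e (t - δ))) n) :
    Γ.ord f (Γ.param e t) = m + n := by
  rw [param_inner ht, ord, slopeUp, slopeDown,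
    GermSlope.derivWithin_Ici (u := fun s => f (Γ.param e s)) hm,
    GermSlope.derivWithin_Iic (u := fun s => f (Γ.param e s)) hn, neg_neg]

namespace IsRational

variable {f g : Γ.Point → ℝ}

theorem const (c : ℝ) : Γ.IsRational fun _ => c := isRational_of_isPL fun _ => IsPL.const c

theorem add (hf : Γ.IsRational f) (hg : Γ.IsRational g) : Γ.IsRational fun p => f p + g p :=
  isRational_of_isPL fun e => (hf.isPL e).add (hg.isPL e)

theorem neg (hf : Γ.IsRational f) : Γ.IsRational fun p => -f p :=
  isRational_of_isPL fun e => (hf.isPL e).neg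

theorem sub (hf : Γ.IsRational f) (hg : Γ.IsRational g) : Γ.IsRational fun p => f p - g p := by
  simpa [sub_eq_add_neg] using hf.add hg.neg

variable [Fintype E]

theorem ord_add (hf : Γ.IsRational f) (hg : Γ.IsRational g) (p : Γ.Point) :
    Γ.ord (fun p => f p + g p) p = Γ.ord f p + Γ.ord g p := by
  rw [ord_eq_sum_of_germSlope fun d hd => (hf.germSlope hd).add (hg.germSlope hd),
    Finset.sum_add_distrib, hf.ord_eq, hg.ord_eq]
  push_cast; rfl

theorem ord_neg (hf : Γ.IsRational f) (p : Γ.Point) :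
    Γ.ord (fun p => -f p) p = -Γ.ord f p := by
  rw [ord_eq_sum_of_germSlope fun d hd => (hf.germSlope hd).neg, Finset.sum_neg_distrib, hf.ord_eq]
  push_cast; rfl

theorem ord_sub (hf : Γ.IsRational f) (hg : Γ.IsRational g) (p : Γ.Point) :
    Γ.ord (fun p => f p - g p) p = Γ.ord f p - Γ.ord g p := by
  simpa [sub_eq_add_neg, hg.ord_neg] using hf.ord_add hg.neg p

theorem sum {ι : Type*} {F : ι → Γ.Point → ℝ} (S : Finset ι) (hF : ∀ i ∈ S, Γ.IsRational (F i)) :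
    Γ.IsRational (fun p => ∑ i ∈ S, F i p) ∧
      ∀ p, Γ.ord (fun p => ∑ i ∈ S, F i p) p = ∑ i ∈ S, Γ.ord (F i) p := by
  classical
  induction S using Finset.induction_on with
  | empty =>
    refine ⟨by simpa using const 0, fun p => ?_⟩
    simpa using ord_eq_sum_of_germSlope (f := fun _ => 0) (p := p) fun d _ => GermSlope.const 0
  | insert a S ha ih =>
    obtain ⟨h1, h2⟩ := ih fun i hi => hF i (Finset.mem_insert_of_mem hi)
    have h3 := hF a (Finset.mem_insert_self a S)
    simp_rw [Finset.sum_insert ha]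
    exact ⟨h3.add h1, fun p => by rw [h3.ord_add h1, h2]⟩

theorem natMul (n : ℕ) (hf : Γ.IsRational f) :
    Γ.IsRational (fun p => n * f p) ∧ ∀ p, Γ.ord (fun p => n * f p) p = n * Γ.ord f p := by
  simpa using sum (F := fun _ => f) (Finset.range n) fun _ _ => hf

theorem ord_nonneg_of_isMin (hf : Γ.IsRational f) {p : Γ.Point} (hp : ∀ q, f p ≤ f q) :
    (∀ d, Γ.IsDir p d → 0 ≤ Γ.slope f p d) ∧ 0 ≤ Γ.ord f p := by
  have h : ∀ d, Γ.IsDir p d → 0 ≤ Γ.slope f p d := fun d hd => by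
    have := (hf.germSlope hd).nonneg_of_le (Eventually.of_forall fun δ => by
      rw [path_zero hd]; exact hp _)
    exact_mod_cast this
  refine ⟨h, ?_⟩
  rw [hf.ord_eq]
  exact_mod_cast Finset.sum_nonneg fun d hd => h d ((mem_dirs Γ).1 hd)

/-- At a point where no slope is negative, a positive slope makes the order positive. -/
theorem one_le_ord (hf : Γ.IsRational f) {p : Γ.Point}
    (h : ∀ d, Γ.IsDir p d → 0 ≤ Γ.slope f p d) {d : E × Bool} (hd : Γ.IsDir p d) {m : ℝ}
    (hm : GermSlope (fun δ => f (Γ.path p d δ)) m) (hm1 : 1 ≤ m) : 1 ≤ Γ.ord f p := by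
  rw [← (hf.germSlope hd).unique hm] at hm1
  have h1 : 1 ≤ Γ.slope f p d := by exact_mod_cast hm1
  rw [hf.ord_eq]
  exact_mod_cast h1.trans (Finset.single_le_sum (f := fun d => Γ.slope f p d)
    (fun d hd => h d ((mem_dirs Γ).1 hd)) ((mem_dirs Γ).2 hd))

/-- At an internal point that is not a breakpoint, f is affine across the point, so its two outgoing
slopes cancel. -/
theorem finite_support [Finite V] (hf : Γ.IsRational f) : {p | Γ.ord f p ≠ 0}.Finite := by
  choose S hS using hf.piecewise
  have hfin : (range (Point.vertex (Γ := Γ)) ∪ ⋃ e, Γ.param e '' (S e : Set ℝ)).Finite :=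
    (finite_range _).union (finite_iUnion fun e => (S e).finite_toSet.image _)
  refine hfin.subset fun p hp => ?_
  rcases p with w | ⟨e, t, ht⟩
  · exact Or.inl ⟨w, rfl⟩
  refine Or.inr (mem_iUnion.2 ⟨e, t, ?_, param_inner ht⟩)
  by_contra htS
  apply hp
  have hopen : IsOpen (Ioo 0 (Γ.len e) \ (S e : Set ℝ)) :=
    isOpen_Ioo.sdiff (S e).finite_toSet.isClosed
  obtain ⟨ε, hε, hball⟩ := Metric.isOpen_iff.1 hopen t ⟨ht, htS⟩
  have hmem : ∀ s ∈ Icc (t - ε / 2) (t + ε / 2), s ∈ Ioo 0 (Γ.len e) \ (S e : Set ℝ) :=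
    fun s hs => hball (by
      rw [Real.ball_eq_Ioo]
      exact ⟨by linarith [hs.1], by linarith [hs.2]⟩)
  obtain ⟨m, hm⟩ := hS e (t - ε / 2) (t + ε / 2) (hmem _ ⟨le_rfl, by linarith⟩).1.1.le (by linarith)
    (hmem _ ⟨by linarith, le_rfl⟩).1.2.le fun s hs hs' => (hmem s ⟨hs'.1.le, hs'.2.le⟩).2 hs
  have h0 := hm t ⟨by linarith, by linarith⟩
  rw [← param_inner ht]
  rw [ord_param_of_germSlope ht (m := m) (n := -m), add_neg_cancel]
  · filter_upwards [eventually_le_nhdsGE (half_pos hε), self_mem_nhdsWithin] with δ h1 h2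
    have h2 : 0 ≤ δ := h2
    rw [hm _ ⟨by linarith, by linarith⟩, add_zero, h0]
    ring
  · filter_upwards [eventually_le_nhdsGE (half_pos hε), self_mem_nhdsWithin] with δ h1 h2
    have h2 : 0 ≤ δ := h2
    rw [hm _ ⟨by linarith, by linarith⟩, sub_zero, h0]
    ring

/-- The principal divisor of a rational function. -/
theorem exists_divisor [Finite V] (hf : Γ.IsRational f) :
    ∃ D : Γ.Divisor, ∀ p, (D p : ℝ) = Γ.ord f p := by
  refine ⟨Finsupp.ofSupportFinite (fun p => ∑ d ∈ Γ.dirs p, Γ.slope f p d) ?_,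
    fun p => (hf.ord_eq p).symm⟩
  refine hf.finite_support.subset fun p hp => ?_
  rw [mem_ofPred_eq, hf.ord_eq]
  exact_mod_cast hp

end IsRational

end MetricGraph

/-! ### The number of leaving edges as a count of directions. -/

namespace MetricGraph

variable {V : Type u} {E : Type v} {Γ : MetricGraph V E}

/-- The direction `d` at `p` leaves the set `X`. -/
def LeavesAlong (Γ : MetricGraph V E) (X : Set Γ.Point) (p : Γ.Point) (d : E × Bool) : Prop :=
  ∀ᶠ δ in 𝓝[>] (0 : ℝ), Γ.path p d δ ∉ X

open Classical in
/-- The directions at `p` that leave `X`. -/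
noncomputable def leavingDirs [Fintype E] (Γ : MetricGraph V E) (X : Set Γ.Point) (p : Γ.Point) :
    Finset (E × Bool) :=
  (Γ.dirs p).filter (Γ.LeavesAlong X p)

theorem mem_leavingDirs [Fintype E] {X : Set Γ.Point} {p : Γ.Point} {d : E × Bool} :
    d ∈ Γ.leavingDirs X p ↔ Γ.IsDir p d ∧ Γ.LeavesAlong X p d := by
  simp [leavingDirs]

theorem Segment.exists_dir {s : Γ.Segment} {p : Γ.Point} (hs : s.HasEnd p) :
    ∃ d, Γ.IsDir p d ∧ d.1 = s.edge ∧
      ∀ᶠ δ in 𝓝[>] (0 : ℝ), Γ.start p d + dirSign d.2 * δ ∈ Ioo s.lo s.hi := by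
  have hlt := s.lo_lt_hi
  rcases hs with h | h
  · obtain ⟨h1, h2⟩ := isDir_param_up s.lo_nonneg (s.lo_lt_hi.trans_le s.hi_le)
    rw [h] at h1 h2
    refine ⟨_, h1, rfl, ?_⟩
    rw [h2]
    filter_upwards [Ioo_mem_nhdsGT (sub_pos.2 hlt)] with δ hδ
    simp only [dirSign_true, mem_Ioo] at hδ ⊢
    constructor <;> linarith
  · obtain ⟨h1, h2⟩ := isDir_param_down (s.lo_nonneg.trans_lt s.lo_lt_hi) s.hi_le
    rw [h] at h1 h2
    refine ⟨_, h1, rfl, ?_⟩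
    rw [h2]
    filter_upwards [Ioo_mem_nhdsGT (sub_pos.2 hlt)] with δ hδ
    simp only [dirSign_false, mem_Ioo] at hδ ⊢
    constructor <;> linarith

theorem Segment.ne_of_mem_interior {s : Γ.Segment} {p q : Γ.Point} (hs : s.HasEnd p)
    (hq : q ∈ s.interior) : q ≠ p := by
  obtain ⟨t, ht, rfl⟩ := hq
  have h0 := s.lo_nonneg
  have h1 := s.hi_le
  have hlt := s.lo_lt_hi
  rintro h
  have ht' : t ∈ Ioo 0 (Γ.len s.edge) := ⟨h0.trans_lt ht.1, ht.2.trans_le h1⟩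
  rcases hs with h' | h' <;> rw [← h'] at h
  · exact ht.1.ne' (param_eq_param ht' ⟨h0, hlt.le.trans h1⟩ h).2
  · exact ht.2.ne (param_eq_param ht' ⟨h0.trans hlt.le, h1⟩ h).2

/-- Assign to each segment a direction at p in which it starts. Two segments with the same direction
overlap near p, so the assignment is injective on internally disjoint segments. -/
theorem IsLeavingCollection.card_le [Fintype E] {X : Set Γ.Point} {p : Γ.Point}
    {C : Finset Γ.Segment} (hC : Γ.IsLeavingCollection X p C) :
    C.card ≤ (Γ.leavingDirs X p).card := by
  classical
  have key : ∀ s : Γ.Segment, ∃ d, s ∈ C → Γ.IsDir p d ∧ d.1 = s.edge ∧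
      ∀ᶠ δ in 𝓝[>] (0 : ℝ), Γ.start p d + dirSign d.2 * δ ∈ Ioo s.lo s.hi := by
    intro s
    by_cases hs : s ∈ C
    · obtain ⟨d, hd⟩ := Segment.exists_dir (hC.1 s hs).2
      exact ⟨d, fun _ => hd⟩
    · exact ⟨(s.edge, true), fun h => absurd h hs⟩
  choose d hd using key
  have hint : ∀ s ∈ C, ∀ᶠ δ in 𝓝[>] (0 : ℝ), Γ.path p (d s) δ ∈ s.interior := by
    intro s hs
    obtain ⟨h1, h2, h3⟩ := hd s hs
    filter_upwards [h3] with δ hδ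
    exact ⟨_, hδ, by rw [path, h2]⟩
  refine Finset.card_le_card_of_injOn d (fun s hs => ?_) fun s hs s' hs' h => ?_
  · refine mem_leavingDirs.2 ⟨(hd s hs).1, ?_⟩
    filter_upwards [hint s hs] with δ hδ hX
    have hsub := (hC.1 s hs).1
    have hmem : Γ.path p (d s) δ ∈ s.points := image_mono Ioo_subset_Icc_self hδ
    exact hsub hmem ⟨hX, Segment.ne_of_mem_interior (hC.1 s hs).2 hδ⟩
  · by_contra hne
    have h1 := hint s hs
    have h2 := hint s' hs'
    rw [← h] at h2
    obtain ⟨δ, h3, h4⟩ := (h1.and h2).exists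
    exact Set.disjoint_left.1 (hC.2 hs hs' hne) h3 h4

theorem leaving_le [Fintype E] {X : Set Γ.Point} {p : Γ.Point} :
    Γ.leaving X p ≤ (Γ.leavingDirs X p).card := by
  refine csSup_le ⟨0, ∅, ⟨by simp, by simp⟩, rfl⟩ ?_
  rintro _ ⟨C, hC, rfl⟩
  exact hC.card_le

theorem bddAbove_leaving [Fintype E] (X : Set Γ.Point) (p : Γ.Point) :
    BddAbove {n : ℕ | ∃ C : Finset Γ.Segment, Γ.IsLeavingCollection X p C ∧ C.card = n} := by
  refine ⟨(Γ.leavingDirs X p).card, ?_⟩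
  rintro _ ⟨C, hC, rfl⟩
  exact hC.card_le

theorem exists_segment {p : Γ.Point} {d : E × Bool} (hd : Γ.IsDir p d) {δ : ℝ} (h0 : 0 < δ)
    (h1 : δ < Γ.room p d) : ∃ s : Γ.Segment, s.HasEnd p ∧
      s.points = Γ.path p d '' Icc 0 δ ∧ s.interior = Γ.path p d '' Ioo 0 δ := by
  have hm := start_mem hd
  have hp := param_start hd
  obtain ⟨e, b⟩ := d
  cases b
  · simp only [room, Bool.false_eq_true, if_false] at h1
    refine ⟨⟨e, Γ.start p (e, false) - δ, Γ.start p (e, false), by linarith, by linarith, hm.2⟩,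
      Or.inr hp, ?_, ?_⟩ <;>
    · have : Γ.path p (e, false) = Γ.param e ∘ fun x => Γ.start p (e, false) - x := by
        ext x
        simp [path, sub_eq_add_neg]
      rw [this, image_comp]
      simp [Segment.points, Segment.interior]
  · simp only [room, if_true] at h1
    refine ⟨⟨e, Γ.start p (e, true), Γ.start p (e, true) + δ, hm.1, by linarith, by linarith⟩,
      Or.inl hp, ?_, ?_⟩ <;>
    · have : Γ.path p (e, true) = Γ.param e ∘ fun x => Γ.start p (e, true) + x := by
        ext x
        simp [path]
      rw [this, image_comp]
      simp [Segment.points, Segment.interior, add_comm]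

/-- The bound by half the length keeps apart the two ends of a loop at its vertex. -/
theorem path_ne_path {p : Γ.Point} {d d' : E × Bool} (hd : Γ.IsDir p d) (hd' : Γ.IsDir p d')
    {δ δ' : ℝ} (h0 : 0 < δ) (h0' : 0 < δ') (h1 : δ < Γ.room p d) (h1' : δ' < Γ.room p d')
    (h2 : δ < Γ.len d.1 / 2) (h2' : δ' < Γ.len d'.1 / 2)
    (h : Γ.path p d δ = Γ.path p d' δ') : d = d' := by
  have hmem := start_add_mem_Ioo hd h0 h1
  have hmem' := start_add_mem_Ioo hd' h0' h1'
  obtain ⟨he, ht⟩ := param_eq_param hmem (Ioo_subset_Icc_self hmem') h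
  obtain ⟨e, b⟩ := d
  obtain ⟨e', b'⟩ := d'
  dsimp only at he
  subst he
  rcases p with w | ⟨e₁, t⟩ <;> cases b <;> cases b' <;> simp [start] at * <;> linarith

/-- Conversely, initial segments of one common small length in the leaving directions are internally
disjoint and meet X at most in p. -/
theorem le_leaving [Fintype E] {X : Set Γ.Point} {p : Γ.Point} :
    (Γ.leavingDirs X p).card ≤ Γ.leaving X p := by
  classical
  have hev : ∀ᶠ δ in 𝓝[>] (0 : ℝ), ∀ d ∈ Γ.leavingDirs X p,
      δ < Γ.room p d ∧ δ < Γ.len d.1 / 2 ∧ ∀ η ∈ Ioc 0 δ, Γ.path p d η ∉ X := by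
    rw [Filter.eventually_all_finset]
    intro d hd
    obtain ⟨h1, h2⟩ := mem_leavingDirs.1 hd
    obtain ⟨ε, hε, H⟩ := eventually_nhdsGT_iff.1 h2
    filter_upwards [Ioo_mem_nhdsGT (room_pos h1), Ioo_mem_nhdsGT (half_pos (Γ.len_pos d.1)),
      eventually_le_nhdsGT hε] with δ h3 h4 h5
    exact ⟨h3.2, h4.2, fun η hη => H η ⟨hη.1, hη.2.trans h5⟩⟩
  obtain ⟨δ, hδ, hδ0⟩ := (hev.and self_mem_nhdsWithin).exists
  have hδ0 : 0 < δ := hδ0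
  have key : ∀ d : {d // d ∈ Γ.leavingDirs X p}, ∃ s : Γ.Segment, s.HasEnd p ∧
      s.points = Γ.path p d '' Icc 0 δ ∧ s.interior = Γ.path p d '' Ioo 0 δ :=
    fun d => exists_segment (mem_leavingDirs.1 d.2).1 hδ0 (hδ d d.2).1
  choose s hs hpts hint using key
  have hdisj : ∀ d d', d ≠ d' → Disjoint (s d).interior (s d').interior := by
    intro d d' hne
    rw [Set.disjoint_left, hint, hint]
    rintro _ ⟨η, hη, rfl⟩ ⟨η', hη', h⟩
    refine hne (Subtype.ext (path_ne_path (mem_leavingDirs.1 d.2).1 (mem_leavingDirs.1 d'.2).1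
      hη.1 hη'.1 ?_ ?_ ?_ ?_ h.symm))
    · exact hη.2.trans (hδ d d.2).1
    · exact hη'.2.trans (hδ d' d'.2).1
    · exact hη.2.trans (hδ d d.2).2.1
    · exact hη'.2.trans (hδ d' d'.2).2.1
  have hinj : Function.Injective s := by
    intro d d' h
    by_contra hne
    have := hdisj d d' hne
    rw [← h, disjoint_self, hint] at this
    have h2 : Γ.path p d (δ / 2) ∈ Γ.path p d '' Ioo 0 δ :=
      ⟨_, ⟨by linarith, by linarith⟩, rfl⟩
    rw [this] at h2
    exact h2
  refine le_csSup (bddAbove_leaving X p)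
    ⟨Finset.univ.image s, ⟨?_, ?_⟩, by rw [Finset.card_image_of_injective _ hinj]; simp⟩
  · intro s' hs'
    obtain ⟨d, -, rfl⟩ := Finset.mem_image.1 hs'
    refine ⟨?_, hs d⟩
    rw [hpts]
    rintro _ ⟨η, hη, rfl⟩ ⟨hX, hne⟩
    rcases hη.1.eq_or_lt with rfl | h
    · exact hne (path_zero (mem_leavingDirs.1 d.2).1)
    · exact (hδ d d.2).2.2 η ⟨h, hη.2⟩ hX
  · intro s₁ h₁ s₂ h₂ hne
    obtain ⟨d, -, rfl⟩ := Finset.mem_image.1 (Finset.mem_coe.1 h₁)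
    obtain ⟨d', -, rfl⟩ := Finset.mem_image.1 (Finset.mem_coe.1 h₂)
    exact hdisj d d' fun h => hne (by rw [h])

theorem leaving_eq [Fintype E] (X : Set Γ.Point) (p : Γ.Point) :
    Γ.leaving X p = (Γ.leavingDirs X p).card :=
  leaving_le.antisymm le_leaving

/-! ### Compactness, the maximum principle and uniqueness. -/

instance compactSpace_point [Finite V] [Finite E] : CompactSpace Γ.Point := by
  constructor
  have : (univ : Set Γ.Point) = range (Point.vertex (Γ := Γ)) ∪
      ⋃ e, Γ.param e '' Icc 0 (Γ.len e) := by
    refine (eq_univ_of_forall fun p => ?_).symm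
    rcases p with w | ⟨e, t⟩
    · exact Or.inl ⟨w, rfl⟩
    · exact Or.inr (mem_iUnion.2 ⟨e, t, Ioo_subset_Icc_self t.2, param_inner t.2⟩)
  rw [this]
  exact (finite_range _).isCompact.union
    (isCompact_iUnion fun e => isCompact_Icc.image (continuous_param e))

/-- A rational function that turns a reduced divisor into one that is effective away from `v₀`
attains its maximum at `v₀`. -/
theorem IsReduced.le_apply [Finite V] [Fintype E] {v₀ : Γ.Point} {D : Γ.Divisor}
    (hD : Γ.IsReduced v₀ D) {f : Γ.Point → ℝ} (hf : Γ.IsRational f)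
    (hpos : ∀ p, p ≠ v₀ → 0 ≤ D p + Γ.ord f p) (q : Γ.Point) : f q ≤ f v₀ := by
  obtain ⟨x, -, hx⟩ := isCompact_univ.exists_isMaxOn ⟨v₀, mem_univ v₀⟩ hf.continuous.continuousOn
  have hx : ∀ y, f y ≤ f x := fun y => hx (mem_univ y)
  suffices f v₀ = f x by rw [this]; exact hx q
  by_contra hv₀
  set M : Set Γ.Point := {y | f y = f x} with hM
  have hMc : IsClosed M := isClosed_eq hf.continuous continuous_const
  have hxM : x ∈ M := rfl
  set X := connectedComponentIn M x with hX
  have hXM : X ⊆ M := connectedComponentIn_subset M x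
  have hXc : IsClosed X := by
    refine isClosed_of_closure_subset ?_
    exact (isPreconnected_connectedComponentIn.closure).subset_connectedComponentIn
      (subset_closure (mem_connectedComponentIn hxM)) (closure_minimal hXM hMc)
  obtain ⟨p, hp, hsat⟩ := hD.2 X hXc (isConnected_connectedComponentIn_iff.2 hxM)
    fun h => hv₀ (hXM h)
  have hpX : p ∈ X := hXc.frontier_subset hp
  have hfp : f p = f x := hXM hpX
  have hpv : p ≠ v₀ := by rintro rfl; exact hv₀ hfp
  apply hsat
  have hle : ∀ d ∈ Γ.dirs p, Γ.slope f p d ≤ 0 := by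
    intro d hd
    rw [mem_dirs] at hd
    have := (hf.germSlope hd).nonpos_of_le (Eventually.of_forall fun δ => by
      rw [path_zero hd, hfp]; exact hx _)
    exact_mod_cast this
  -- A slope 0 would keep f maximal along an initial path, which would then lie in the component X
  -- and not leave it. Being a nonpositive integer, the slope is at most -1.
  have hlt : ∀ d ∈ Γ.leavingDirs X p, Γ.slope f p d ≤ -1 := by
    intro d hd
    obtain ⟨h1, h2⟩ := mem_leavingDirs.1 hd
    by_contra h3
    have h4 : Γ.slope f p d = 0 := le_antisymm (hle d ((mem_dirs Γ).2 h1)) (by linarith)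
    have h5 := hf.germSlope h1
    rw [h4] at h5
    obtain ⟨ε, hε, H⟩ := eventually_nhdsGE_iff.1 h5
    have hsub : Γ.path p d '' Icc 0 ε ⊆ X := by
      rw [hX, connectedComponentIn_eq hpX]
      have hpre := (isPreconnected_Icc (a := 0) (b := ε)).image _
        (continuous_path p d).continuousOn
      refine hpre.subset_connectedComponentIn
        ⟨0, ⟨le_rfl, hε.le⟩, path_zero h1⟩ ?_
      rintro _ ⟨δ, hδ, rfl⟩
      have := H δ hδ
      simp only [path_zero h1, hfp] at this
      simpa [hM] using this
    obtain ⟨δ, h6, h7, h8⟩ := (h2.and ((eventually_le_nhdsGT hε).and self_mem_nhdsWithin)).exists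
    have h8 : 0 < δ := h8
    exact h6 (hsub ⟨δ, ⟨h8.le, h7⟩, rfl⟩)
  have hsum : ∑ d ∈ Γ.dirs p, Γ.slope f p d ≤ -((Γ.leavingDirs X p).card : ℤ) := by
    have h := Finset.sum_le_sum_of_subset_of_nonneg (f := fun d => -Γ.slope f p d)
      (show Γ.leavingDirs X p ⊆ Γ.dirs p from
        fun d hd => (mem_dirs Γ).2 (mem_leavingDirs.1 hd).1)
      fun d hd _ => neg_nonneg.2 (hle d hd)
    have h' : ∑ d ∈ Γ.leavingDirs X p, 1 ≤ ∑ d ∈ Γ.leavingDirs X p, -Γ.slope f p d :=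
      Finset.sum_le_sum fun d hd => by linarith [hlt d hd]
    simp only [Finset.sum_neg_distrib] at h h'
    rw [Finset.sum_const, nsmul_eq_mul, mul_one] at h'
    linarith
  have h9 := hpos p hpv
  rw [hf.ord_eq] at h9
  have h10 : 0 ≤ D p + ∑ d ∈ Γ.dirs p, Γ.slope f p d := by exact_mod_cast h9
  rw [Saturated, leaving_eq]
  linarith

theorem ord_const [Fintype E] (c : ℝ) (p : Γ.Point) : Γ.ord (fun _ => c) p = 0 := by
  rw [ord_eq_sum_of_germSlope (m := fun _ => 0) fun d _ => GermSlope.const c]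
  simp

theorem IsReduced.eq_of_linEquiv [Finite V] [Fintype E] {v₀ : Γ.Point} {D D₁ D₂ : Γ.Divisor}
    (h₁ : Γ.IsReduced v₀ D₁) (h₂ : Γ.IsReduced v₀ D₂) (e₁ : Γ.LinEquiv D₁ D)
    (e₂ : Γ.LinEquiv D₂ D) : D₁ = D₂ := by
  obtain ⟨f₁, hf₁, H₁⟩ := e₁
  obtain ⟨f₂, hf₂, H₂⟩ := e₂
  have hle := h₁.le_apply (hf₂.sub hf₁) fun p hp => by
    have : (0 : ℝ) ≤ D₂ p := by exact_mod_cast h₂.1 p hp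
    rw [hf₂.ord_sub hf₁]; linarith [H₁ p, H₂ p]
  have hge := h₂.le_apply (hf₁.sub hf₂) fun p hp => by
    have : (0 : ℝ) ≤ D₁ p := by exact_mod_cast h₁.1 p hp
    rw [hf₁.ord_sub hf₂]; linarith [H₁ p, H₂ p]
  have hconst : (fun p => f₂ p - f₁ p) = fun _ => f₂ v₀ - f₁ v₀ := by
    funext q
    linarith [hle q, hge q]
  ext p
  have h := hf₂.ord_sub hf₁ p
  rw [hconst, ord_const] at h
  have : (D₁ p : ℝ) = D₂ p := by linarith [H₁ p, H₂ p]
  exact_mod_cast this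

end MetricGraph

/-! ### Convex kinks, and gluing functions from the edges. -/

/-- The sum of the two outgoing slopes of `u` at `t` is nonnegative. -/
def ConvexKink (u : ℝ → ℝ) (t : ℝ) : Prop :=
  ∃ m n : ℝ, GermSlope (fun δ => u (t + δ)) m ∧ GermSlope (fun δ => u (t - δ)) n ∧ 0 ≤ m + n

namespace ConvexKink

variable {u v : ℝ → ℝ} {t : ℝ}

theorem affine (m c : ℝ) : ConvexKink (fun s => m * s + c) t := by
  refine ⟨m, -m, ?_, ?_, by simp⟩ <;> filter_upwards with δ <;> ring

theorem const (c : ℝ) : ConvexKink (fun _ => c) t := by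
  simpa using affine (t := t) 0 c

theorem add (hu : ConvexKink u t) (hv : ConvexKink v t) : ConvexKink (fun s => u s + v s) t := by
  obtain ⟨m, n, h1, h2, h3⟩ := hu
  obtain ⟨m', n', h1', h2', h3'⟩ := hv
  exact ⟨m + m', n + n', h1.add h1', h2.add h2', by linarith⟩

/-- Where one function is larger, its slopes count; at a tie both slopes can only grow. -/
theorem max (hu : ConvexKink u t) (hv : ConvexKink v t) :
    ConvexKink (fun s => max (u s) (v s)) t := by
  obtain ⟨m, n, h1, h2, h3⟩ := hu
  obtain ⟨m', n', h1', h2', h3'⟩ := hv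
  rcases lt_trichotomy (u t) (v t) with h | h | h
  · simp_rw [max_comm (u _)]
    exact ⟨m', n', h1'.max_of_lt h1 (by simpa using h), h2'.max_of_lt h2 (by simpa using h), h3'⟩
  · exact ⟨_, _, h1.max_of_eq h1' (by simpa using h.symm), h2.max_of_eq h2' (by simpa using h.symm),
      by linarith [le_max_left m m', le_max_left n n']⟩
  · exact ⟨m, n, h1.max_of_lt h1' (by simpa using h), h2.max_of_lt h2' (by simpa using h), h3⟩

theorem congr (hu : ConvexKink u t) (h : ∀ᶠ s in 𝓝 t, v s = u s) : ConvexKink v t := by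
  obtain ⟨m, n, h1, h2, h3⟩ := hu
  refine ⟨m, n, h1.congr ?_, h2.congr ?_, h3⟩
  · have : Tendsto (fun δ : ℝ => t + δ) (𝓝[≥] 0) (𝓝 (t + 0)) :=
      (Continuous.tendsto (by fun_prop) 0).mono_left nhdsWithin_le_nhds
    rw [add_zero] at this
    exact this.eventually h
  · have : Tendsto (fun δ : ℝ => t - δ) (𝓝[≥] 0) (𝓝 (t - 0)) :=
      (Continuous.tendsto (by fun_prop) 0).mono_left nhdsWithin_le_nhds
    rw [sub_zero] at this
    exact this.eventually h

end ConvexKink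

namespace MetricGraph

variable {V : Type u} {E : Type v} {Γ : MetricGraph V E}

/-- The function with the given values at the vertices and on the edges. -/
def glue (Γ : MetricGraph V E) (c : V → ℝ) (u : E → ℝ → ℝ) : Γ.Point → ℝ
  | Point.vertex w => c w
  | Point.inner e t => u e t

section Glue

variable {c : V → ℝ} {u : E → ℝ → ℝ}

theorem glue_param (h0 : ∀ e, u e 0 = c (Γ.src e))
    (h1 : ∀ e, u e (Γ.len e) = c (Γ.tgt e)) {e : E} {t : ℝ} (ht : t ∈ Icc 0 (Γ.len e)) :
    Γ.glue c u (Γ.param e t) = u e t := by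
  rcases ht.1.eq_or_lt with rfl | h2
  · simp [glue, h0]
  rcases ht.2.eq_or_lt with rfl | h3
  · simp [glue, h1]
  rw [param_inner ⟨h2, h3⟩, glue]

theorem isRational_glue (h0 : ∀ e, u e 0 = c (Γ.src e))
    (h1 : ∀ e, u e (Γ.len e) = c (Γ.tgt e)) (hu : ∀ e, IsPL (u e)) :
    Γ.IsRational (Γ.glue c u) :=
  isRational_of_edges fun e => ⟨u e, hu e, fun _ ht => glue_param h0 h1 ht⟩

theorem ord_glue_nonneg [Fintype E] (h0 : ∀ e, u e 0 = c (Γ.src e))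
    (h1 : ∀ e, u e (Γ.len e) = c (Γ.tgt e))
    {e : E} {t : ℝ} (ht : t ∈ Ioo 0 (Γ.len e))
    (h : ConvexKink (u e) t) : 0 ≤ Γ.ord (Γ.glue c u) (Γ.param e t) := by
  have h2 : ConvexKink (fun s => Γ.glue c u (Γ.param e s)) t := h.congr (by
    filter_upwards [Icc_mem_nhds ht.1 ht.2] with s hs
    exact glue_param h0 h1 hs)
  obtain ⟨m, n, h3, h4, h5⟩ := h2
  rwa [ord_param_of_germSlope ht h3 h4]

theorem germSlope_glue (h0 : ∀ e, u e 0 = c (Γ.src e))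
    (h1 : ∀ e, u e (Γ.len e) = c (Γ.tgt e))
    {p : Γ.Point} {d : E × Bool} (hd : Γ.IsDir p d) {m : ℝ}
    (h : GermSlope (fun δ => u d.1 (Γ.start p d + dirSign d.2 * δ)) m) :
    GermSlope (fun δ => Γ.glue c u (Γ.path p d δ)) m := by
  refine h.congr ?_
  filter_upwards [eventually_le_nhdsGE (room_pos hd), self_mem_nhdsWithin] with δ h2 h3
  exact glue_param h0 h1 (start_add_mem hd h3 h2)

end Glue

variable [Fintype E]

/-! ### Making a divisor effective away from a point. -/

/-- Some rational function has nonnegative order away from `q` and positive order at `p`,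
unless `p = q`. -/
def Reaches (Γ : MetricGraph V E) (q p : Γ.Point) : Prop :=
  ∃ f, Γ.IsRational f ∧ (∀ x, x ≠ q → 0 ≤ Γ.ord f x) ∧ (p = q ∨ 1 ≤ Γ.ord f p)

theorem Reaches.refl (p : Γ.Point) : Γ.Reaches p p :=
  ⟨fun _ => 0, .const 0, fun x _ => (ord_const 0 x).ge, Or.inl rfl⟩

/-- Sufficiently many copies of the function for (r, q) compensate the negative order at q of the
function for (q, p). -/
theorem Reaches.trans {p q r : Γ.Point} (h₁ : Γ.Reaches r q) (h₂ : Γ.Reaches q p) :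
    Γ.Reaches r p := by
  by_cases hpr : p = r
  · rw [hpr]; exact .refl r
  by_cases hpq : p = q
  · rwa [hpq]
  by_cases hqr : q = r
  · rwa [← hqr]
  obtain ⟨g, hg, hg1, hg2⟩ := h₁
  obtain ⟨f, hf, hf1, hf2⟩ := h₂
  have hg2 := hg2.resolve_left hqr
  have hf2 := hf2.resolve_left hpq
  obtain ⟨n, hn⟩ := exists_nat_ge (-Γ.ord f q)
  obtain ⟨h3, h4⟩ := hg.natMul n
  refine ⟨_, hf.add h3, fun x hx => ?_, Or.inr ?_⟩
  · rw [hf.ord_add h3, h4]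
    by_cases hxq : x = q
    · subst hxq
      nlinarith
    · exact add_nonneg (hf1 x hxq) (mul_nonneg n.cast_nonneg (hg1 x hx))
  · rw [hf.ord_add h3, h4]
    linarith [mul_nonneg (n.cast_nonneg (α := ℝ)) (hg1 p hpr)]

/-- A tent on the edge with peak at t: it rises from t' with slope 1, which gives order at least 1
at t', and only the peak has negative order. -/
theorem reaches_of_inner_aux {e : E} {t t' : ℝ} (ht : t ∈ Ioo 0 (Γ.len e))
    (ht' : t' ∈ Icc 0 (Γ.len e)) (b : Bool) (hlt : 0 < dirSign b * (t - t')) :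
    Γ.Reaches (Γ.param e t) (Γ.param e t') := by
  classical
  set σ := dirSign b with hσ
  have hroom : 0 < if b then Γ.len e - t else t := by
    cases b
    · simpa using ht.1
    · simpa using ht.2
  -- The integer n is the slope of the far side of the tent, steep enough to come down to 0 by the
  -- end of the edge.
  obtain ⟨n, hn⟩ := exists_nat_ge (σ * (t - t') / if b then Γ.len e - t else t)
  rw [div_le_iff₀ hroom] at hn
  set w : ℝ → ℝ := fun s => max 0 (min (σ * (s - t')) (σ * (t - t') - n * (σ * (s - t)))) with hw
  have hwPL : IsPL w := by
    refine (IsPL.const 0).max (IsPL.min ?_ ?_)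
    · have := IsPL.affine (if b then 1 else -1) (-(σ * t'))
      convert this using 2 with s
      cases b <;> simp [hσ] <;> ring
    · have := IsPL.affine (if b then -n else n) (σ * (t - t') + n * (σ * t))
      convert this using 2 with s
      cases b <;> simp [hσ] <;> ring
  have hw0 : w 0 = 0 := by
    refine max_eq_left ?_
    cases b
    · refine (min_le_right _ _).trans ?_
      simp [hσ] at hn ⊢; linarith
    · refine (min_le_left _ _).trans ?_
      simp [hσ]; exact ht'.1
  have hw1 : w (Γ.len e) = 0 := by
    refine max_eq_left ?_
    cases b
    · refine (min_le_left _ _).trans ?_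
      simp [hσ]; exact ht'.2
    · refine (min_le_right _ _).trans ?_
      simp [hσ] at hn ⊢; linarith
  have hkink : ∀ s, s ≠ t → ConvexKink w s := by
    intro s hs
    have hne : σ * (s - t) ≠ 0 := by
      refine mul_ne_zero ?_ (sub_ne_zero.2 hs)
      cases b <;> simp [hσ]
    have hc : Continuous fun s => σ * (s - t) := by fun_prop
    rcases hne.lt_or_gt with h | h
    · refine ((ConvexKink.const 0).max (ConvexKink.affine σ (-(σ * t')))).congr ?_
      filter_upwards [hc.tendsto s |>.eventually_lt_const h] with x hx
      rw [hw]
      dsimp only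
      rw [min_eq_left (by nlinarith [n.cast_nonneg (α := ℝ)])]
      ring_nf
    · refine ((ConvexKink.const 0).max
        (ConvexKink.affine (-(n * σ)) (σ * (t - t') + n * (σ * t)))).congr ?_
      filter_upwards [hc.tendsto s |>.eventually_const_lt h] with x hx
      rw [hw]
      dsimp only
      rw [min_eq_right (by nlinarith [n.cast_nonneg (α := ℝ)])]
      ring_nf
  set u : E → ℝ → ℝ := fun e' => if e' = e then w else fun _ => 0 with hu
  have h0 : ∀ e', u e' 0 = (fun _ : V => (0 : ℝ)) (Γ.src e') := by
    intro e'
    by_cases h : e' = e <;> simp [hu, h, hw0]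
  have h1 : ∀ e', u e' (Γ.len e') = (fun _ : V => (0 : ℝ)) (Γ.tgt e') := by
    intro e'
    by_cases h : e' = e
    · subst h; simp [hu, hw1]
    · simp [hu, h]
  have hrat : Γ.IsRational (Γ.glue (fun _ => 0) u) := isRational_glue h0 h1 fun e' => by
    by_cases h : e' = e
    · simpa [hu, h] using hwPL
    · simpa [hu, h] using IsPL.const 0
  have hnonneg : ∀ x, 0 ≤ Γ.glue (fun _ => 0) u x := by
    rintro (w' | ⟨e', s⟩)
    · exact le_rfl
    · by_cases h : e' = e <;> simp [glue, hu, h, hw]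
  refine ⟨_, hrat, fun x hx => ?_, Or.inr ?_⟩
  · rcases x with w' | ⟨e', s, hs⟩
    · exact (hrat.ord_nonneg_of_isMin (p := Point.vertex w') hnonneg).2
    · rw [← param_inner hs] at hx ⊢
      refine ord_glue_nonneg h0 h1 hs ?_
      by_cases h : e' = e
      · subst h
        simp only [hu, if_true]
        exact hkink s fun h => hx (by rw [h])
      · simpa [hu, h] using ConvexKink.const 0
  · have hdir : Γ.IsDir (Γ.param e t') (e, b) ∧ Γ.start (Γ.param e t') (e, b) = t' := by
      cases b
      · simp [hσ] at hlt
        exact isDir_param_down (by linarith [ht.1]) ht'.2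
      · simp [hσ] at hlt
        exact isDir_param_up ht'.1 (by linarith [ht.2])
    have hσσ : σ * σ = 1 := by cases b <;> simp [hσ]
    have hzero : Γ.glue (fun _ => 0) u (Γ.param e t') = 0 := by
      rw [glue_param h0 h1 ht']
      simp [hu, hw]
    refine hrat.one_le_ord (hrat.ord_nonneg_of_isMin fun q => ?_).1 hdir.1 (m := 1) ?_ le_rfl
    · rw [hzero]; exact hnonneg q
    refine germSlope_glue h0 h1 hdir.1 ?_
    rw [hdir.2]
    simp only [hu, if_true]
    filter_upwards [eventually_le_nhdsGE hlt, self_mem_nhdsWithin] with δ h2 h3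
    have h3 : 0 ≤ δ := h3
    have h4 : σ * (t' + σ * δ - t') = δ := by linear_combination δ * hσσ
    have h5 : σ * (t' + σ * δ - t) = δ - σ * (t - t') := by linear_combination δ * hσσ
    have h6 : (0 : ℝ) ≤ n * (σ * (t - t') - δ) := mul_nonneg n.cast_nonneg (by linarith)
    rw [hw]
    dsimp only
    rw [← hσ, h4, h5, min_eq_left (by linarith), max_eq_right h3]
    simp

theorem reaches_of_inner {e : E} {t t' : ℝ} (ht : t ∈ Ioo 0 (Γ.len e))
    (ht' : t' ∈ Icc 0 (Γ.len e)) : Γ.Reaches (Γ.param e t) (Γ.param e t') := by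
  rcases lt_trichotomy t' t with h | rfl | h
  · exact reaches_of_inner_aux ht ht' true (by simpa using h)
  · exact .refl _
  · exact reaches_of_inner_aux ht ht' false (by simpa using h)

/-- A cone of height r and slope 1 about the vertex q; the point found is its foot on the given
edge, at distance r from q. -/
theorem exists_reaches_of_vertex {q : V} {d : E × Bool} (hd : Γ.IsDir (Point.vertex q) d) :
    ∃ t ∈ Ioo 0 (Γ.len d.1), Γ.Reaches (Point.vertex q) (Γ.param d.1 t) := by
  classical
  -- With r below half of every length, the two parts of the cone on a loop do not overlap.
  have hev : ∀ᶠ r in 𝓝[>] (0 : ℝ), ∀ e, r < Γ.len e / 2 := by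
    rw [eventually_all]
    intro e
    filter_upwards [Ioo_mem_nhdsGT (half_pos (Γ.len_pos e))] with r hr using hr.2
  obtain ⟨r, hr, hr0⟩ := (hev.and self_mem_nhdsWithin).exists
  have hr0 : 0 < r := hr0
  set a : E → ℝ → ℝ := fun e s => if Γ.src e = q then max 0 (r - s) else 0 with ha
  set z : E → ℝ → ℝ := fun e s => if Γ.tgt e = q then max 0 (r - (Γ.len e - s)) else 0 with hz
  have ha0 : ∀ e s, r ≤ s → a e s = 0 := by
    intro e s hs
    simp only [ha, max_eq_left (sub_nonpos.2 hs), ite_self]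
  have hz0 : ∀ e s, s ≤ Γ.len e - r → z e s = 0 := by
    intro e s hs
    simp only [hz, max_eq_left (show r - (Γ.len e - s) ≤ 0 by linarith), ite_self]
  set c : V → ℝ := fun w => if w = q then r else 0 with hc
  set u : E → ℝ → ℝ := fun e s => a e s + z e s with hu
  have h0 : ∀ e, u e 0 = c (Γ.src e) := by
    intro e
    simp only [hu]
    rw [hz0 e 0 (by linarith [hr e])]
    simp [ha, hc, hr0.le]
  have h1 : ∀ e, u e (Γ.len e) = c (Γ.tgt e) := by
    intro e
    simp only [hu]
    rw [ha0 e _ (by linarith [hr e])]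
    simp [hz, hc, hr0.le]
  have hPL : ∀ e, IsPL (u e) := by
    intro e
    refine IsPL.add ?_ ?_
    · by_cases h : Γ.src e = q
      · simp only [ha, h, if_true]
        refine (IsPL.const 0).max ?_
        convert IsPL.affine (-1) r using 2 with s
        push_cast; ring
      · simpa [ha, h] using IsPL.const 0
    · by_cases h : Γ.tgt e = q
      · simp only [hz, h, if_true]
        refine (IsPL.const 0).max ?_
        convert IsPL.affine 1 (r - Γ.len e) using 2 with s
        push_cast; ring
      · simpa [hz, h] using IsPL.const 0
  have hkink : ∀ e s, ConvexKink (u e) s := by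
    intro e s
    refine ConvexKink.add ?_ ?_
    · by_cases h : Γ.src e = q
      · simp only [ha, h, if_true]
        refine (ConvexKink.const 0).max ?_
        convert ConvexKink.affine (-1) r using 2 with s
        ring
      · simpa [ha, h] using ConvexKink.const 0
    · by_cases h : Γ.tgt e = q
      · simp only [hz, h, if_true]
        refine (ConvexKink.const 0).max ?_
        convert ConvexKink.affine 1 (r - Γ.len e) using 2 with s
        ring
      · simpa [hz, h] using ConvexKink.const 0
  have hrat : Γ.IsRational (Γ.glue c u) := isRational_glue h0 h1 hPL
  have hnonneg : ∀ x, 0 ≤ Γ.glue c u x := by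
    rintro (w' | ⟨e', s⟩)
    · simp only [glue, hc]; split_ifs <;> simp [hr0.le]
    · refine add_nonneg ?_ ?_
      · simp only [ha]; split_ifs <;> simp
      · simp only [hz]; split_ifs <;> simp
  have hord : ∀ x, x ≠ Point.vertex q → 0 ≤ Γ.ord (Γ.glue c u) x := by
    rintro (w' | ⟨e', s, hs⟩) hx
    · refine (hrat.ord_nonneg_of_isMin fun x => ?_).2
      have : w' ≠ q := fun h => hx (by rw [h])
      simpa [glue, hc, this] using hnonneg x
    · rw [← param_inner hs]
      exact ord_glue_nonneg h0 h1 hs (hkink e' s)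
  obtain ⟨e, b⟩ := d
  have hre := hr e
  cases b
  · have hq : Γ.tgt e = q := by simpa [IsDir] using hd
    have ht : Γ.len e - r ∈ Ioo 0 (Γ.len e) := ⟨by linarith, by linarith⟩
    refine ⟨_, ht, _, hrat, hord, Or.inr ?_⟩
    have hdir := isDir_param_up ht.1.le ht.2
    have hval : Γ.glue c u (Γ.param e (Γ.len e - r)) = 0 := by
      rw [glue_param h0 h1 (Ioo_subset_Icc_self ht)]
      simp only [hu]
      rw [ha0 e _ (by linarith), hz0 e _ le_rfl, add_zero]
    refine hrat.one_le_ord (hrat.ord_nonneg_of_isMin fun x => ?_).1 hdir.1 (m := 1) ?_ le_rfl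
    · rw [hval]; exact hnonneg x
    refine germSlope_glue h0 h1 hdir.1 ?_
    rw [hdir.2]
    filter_upwards [self_mem_nhdsWithin] with δ h3
    have h3 : 0 ≤ δ := h3
    simp only [hu, dirSign_true, one_mul, add_zero]
    rw [ha0 e _ (by linarith), ha0 e _ (by linarith)]
    have h4 : r - (Γ.len e - (Γ.len e - r + δ)) = δ := by ring
    simp [hz, hq, h3, h4]
  · have hq : Γ.src e = q := by simpa [IsDir] using hd
    have ht : r ∈ Ioo 0 (Γ.len e) := ⟨by linarith, by linarith⟩
    refine ⟨_, ht, _, hrat, hord, Or.inr ?_⟩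
    have hdir := isDir_param_down ht.1 ht.2.le
    have hval : Γ.glue c u (Γ.param e r) = 0 := by
      rw [glue_param h0 h1 (Ioo_subset_Icc_self ht)]
      simp only [hu]
      rw [ha0 e _ le_rfl, hz0 e _ (by linarith), add_zero]
    refine hrat.one_le_ord (hrat.ord_nonneg_of_isMin fun x => ?_).1 hdir.1 (m := 1) ?_ le_rfl
    · rw [hval]; exact hnonneg x
    refine germSlope_glue h0 h1 hdir.1 ?_
    rw [hdir.2]
    filter_upwards [self_mem_nhdsWithin] with δ h3
    have h3 : 0 ≤ δ := h3
    simp only [hu, dirSign_false]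
    rw [hz0 e _ (by linarith), hz0 e _ (by linarith)]
    simp [ha, hq, h3]

theorem reaches_of_edge {e : E} {t t' : ℝ} (ht : t ∈ Icc 0 (Γ.len e))
    (ht' : t' ∈ Icc 0 (Γ.len e)) : Γ.Reaches (Γ.param e t) (Γ.param e t') := by
  rcases ht.1.eq_or_lt with rfl | h0
  · obtain ⟨s, hs, h⟩ := exists_reaches_of_vertex (Γ := Γ) (q := Γ.src e) (d := (e, true)) rfl
    rw [param_zero]
    exact h.trans (reaches_of_inner hs ht')
  rcases ht.2.eq_or_lt with rfl | h1
  · obtain ⟨s, hs, h⟩ := exists_reaches_of_vertex (Γ := Γ) (q := Γ.tgt e) (d := (e, false)) rfl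
    rw [param_len]
    exact h.trans (reaches_of_inner hs ht')
  · exact reaches_of_inner ⟨h0, h1⟩ ht'

theorem reaches_vertex (a b : V) : Γ.Reaches (Point.vertex a) (Point.vertex b) := by
  have h := Γ.connected a b
  suffices Γ.Reaches (Point.vertex a) (Point.vertex b) ∧
    Γ.Reaches (Point.vertex b) (Point.vertex a) from this.1
  induction h with
  | rel x y h =>
    obtain ⟨e, rfl, rfl⟩ := h
    have h0 : (0 : ℝ) ∈ Icc 0 (Γ.len e) := ⟨le_rfl, (Γ.len_pos e).le⟩
    have h1 : Γ.len e ∈ Icc 0 (Γ.len e) := ⟨(Γ.len_pos e).le, le_rfl⟩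
    rw [← param_zero, ← param_len]
    exact ⟨reaches_of_edge h0 h1, reaches_of_edge h1 h0⟩
  | refl x => exact ⟨.refl _, .refl _⟩
  | symm x y _ ih => exact ih.symm
  | trans x y z _ _ ih₁ ih₂ => exact ⟨ih₁.1.trans ih₂.1, ih₂.2.trans ih₁.2⟩

theorem exists_vertex_reaches (p : Γ.Point) :
    ∃ w : V, Γ.Reaches (Point.vertex w) p ∧ Γ.Reaches p (Point.vertex w) := by
  rcases p with w | ⟨e, t, ht⟩
  · exact ⟨w, .refl _, .refl _⟩
  · have h0 : (0 : ℝ) ∈ Icc 0 (Γ.len e) := ⟨le_rfl, (Γ.len_pos e).le⟩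
    refine ⟨Γ.src e, ?_⟩
    rw [← param_zero, ← param_inner ht]
    exact ⟨reaches_of_edge h0 (Ioo_subset_Icc_self ht), reaches_of_inner ht h0⟩

theorem reaches (q p : Γ.Point) : Γ.Reaches q p := by
  obtain ⟨a, -, ha⟩ := exists_vertex_reaches q
  obtain ⟨b, hb, -⟩ := exists_vertex_reaches p
  exact ha.trans ((reaches_vertex a b).trans hb)

/-- Every divisor can be bounded away from a given point by a principal divisor. -/
theorem exists_le_ord (v₀ : Γ.Point) (D : Γ.Divisor) :
    ∃ f, Γ.IsRational f ∧ ∀ x, x ≠ v₀ → (D x : ℝ) ≤ Γ.ord f x := by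
  choose f hf h0 h1 using fun p : Γ.Point => reaches v₀ p
  -- The sum of |D(p)| copies of a function reaching p, over the support of D. Off v₀ no term has
  -- negative order, and the term of x alone gives at least D(x).
  have hsum := IsRational.sum (F := fun p x => ((D p).natAbs : ℝ) * f p x) D.support
    fun p _ => ((hf p).natMul _).1
  refine ⟨_, hsum.1, fun x hx => ?_⟩
  rw [hsum.2]
  simp only [fun p => ((hf p).natMul (D p).natAbs).2 x]
  have hnn : ∀ p ∈ D.support, 0 ≤ ((D p).natAbs : ℝ) * Γ.ord (f p) x :=
    fun p _ => mul_nonneg (Nat.cast_nonneg _) (h0 p x hx)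
  by_cases hxs : x ∈ D.support
  · refine le_trans ?_ (Finset.single_le_sum hnn hxs)
    have h2 := (h1 x).resolve_left hx
    have h3 : (D x : ℝ) ≤ ((D x).natAbs : ℝ) := by
      rw [Nat.cast_natAbs]; exact_mod_cast le_abs_self (D x)
    nlinarith [Nat.cast_nonneg (α := ℝ) (D x).natAbs]
  · rw [Finsupp.notMem_support_iff.1 hxs, Int.cast_zero]
    exact Finset.sum_nonneg hnn

end MetricGraph

/-! ### Convexity and integral subgradients on an interval. -/

/-- Maximum principle: a continuous function with convex kinks only attains its maximum on an
interval at an end. -/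
theorem nonpos_of_convexKink {g : ℝ → ℝ} {x y : ℝ} (hg : ContinuousOn g (Icc x y)) (hx : g x ≤ 0)
    (hy : g y ≤ 0) (h : ∀ t ∈ Ioo x y, ConvexKink g t) : ∀ t ∈ Icc x y, g t ≤ 0 := by
  intro t₀ ht₀
  by_contra hpos
  have hpos : 0 < g t₀ := not_le.1 hpos
  obtain ⟨M, hM, hmax⟩ := isCompact_Icc.exists_isMaxOn ⟨t₀, ht₀⟩ hg
  have hmax : ∀ s ∈ Icc x y, g s ≤ g M := fun s hs => hmax hs
  set A : Set ℝ := Icc x y ∩ g ⁻¹' {g M}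
  have hAc : IsClosed A := hg.preimage_isClosed_of_isClosed isClosed_Icc isClosed_singleton
  have hAK : IsCompact A := isCompact_Icc.of_isClosed_subset hAc inter_subset_left
  obtain ⟨ht, htM⟩ := hAK.sInf_mem ⟨M, hM, rfl⟩
  -- At the leftmost maximum both slopes are nonpositive with nonnegative sum, so both vanish and
  -- the maximum extends further left.
  set t := sInf A
  have htM : g t = g M := htM
  have htpos : 0 < g t := by rw [htM]; exact hpos.trans_le (hmax t₀ ht₀)
  have h1 : x < t := lt_of_le_of_ne ht.1 (by rintro h; rw [← h] at htpos; linarith)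
  have h2 : t < y := lt_of_le_of_ne ht.2 (by rintro h; rw [h] at htpos; linarith)
  obtain ⟨m, n, hm, hn, hmn⟩ := h t ⟨h1, h2⟩
  have hm0 : m ≤ 0 := hm.nonpos_of_le (by
    filter_upwards [eventually_le_nhdsGT (sub_pos.2 h2), self_mem_nhdsWithin] with δ h3 h4
    have h4 : 0 < δ := h4
    rw [add_zero, htM]
    exact hmax _ ⟨by linarith, by linarith⟩)
  have hn0 : n ≤ 0 := hn.nonpos_of_le (by
    filter_upwards [eventually_le_nhdsGT (sub_pos.2 h1), self_mem_nhdsWithin] with δ h3 h4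
    have h4 : 0 < δ := h4
    rw [sub_zero, htM]
    exact hmax _ ⟨by linarith, by linarith⟩)
  have hn0 : n = 0 := by linarith
  obtain ⟨δ, h3, h4, h5⟩ := ((eventually_nhdsGT_of_nhdsGE hn).and
    ((eventually_le_nhdsGT (sub_pos.2 h1)).and self_mem_nhdsWithin)).exists
  have h5 : 0 < δ := h5
  have h6 : t - δ ∈ A := by
    refine ⟨⟨by linarith, by linarith⟩, ?_⟩
    simp only [hn0, zero_mul, add_zero, sub_zero, htM] at h3
    exact h3
  have := csInf_le hAK.bddBelow h6
  linarith

/-- Subtract the chord, which keeps the kinks convex, and apply the maximum principle. -/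
theorem convexOn_of_convexKink {u : ℝ → ℝ} {a b : ℝ} (hu : ContinuousOn u (Icc a b))
    (h : ∀ t ∈ Ioo a b, ConvexKink u t) : ConvexOn ℝ (Icc a b) u := by
  refine LinearOrder.convexOn_of_lt (convex_Icc a b) fun x hx y hy hxy α β hα hβ hαβ => ?_
  have hyx : 0 < y - x := sub_pos.2 hxy
  set k := (u y - u x) / (y - x) with hk
  have hky : k * (y - x) = u y - u x := div_mul_cancel₀ _ hyx.ne'
  have hsub : Icc x y ⊆ Icc a b := Icc_subset_Icc hx.1 hy.2
  have hmem : α * x + β * y ∈ Icc x y := by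
    have h2 : α = 1 - β := by linarith
    constructor <;> rw [h2] <;> nlinarith
  have := nonpos_of_convexKink (g := fun s => u s + (-k * s + (k * x - u x))) (x := x) (y := y)
    ((hu.mono hsub).add (Continuous.continuousOn (by fun_prop))) (by linarith) (by linarith)
    (fun t ht => (h t ⟨hx.1.trans_lt ht.1, ht.2.trans_le hy.2⟩).add (ConvexKink.affine _ _))
    _ hmem
  simp only [smul_eq_mul]
  have h2 : α = 1 - β := by linarith
  subst h2
  have h3 : k * ((1 - β) * x + β * y) = k * x + β * (k * (y - x)) := by ring
  rw [hky] at h3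
  linarith

/-- A function with integral subgradients of bounded size is a maximum of finitely many affine
functions with integral slopes. -/
theorem exists_isPL_of_subgradients {u : ℝ → ℝ} {L : ℝ} (hL : 0 ≤ L) {K : ℤ}
    (h : ∀ s ∈ Icc 0 L, ∃ m ∈ Finset.Icc (-K) K, ∀ y ∈ Icc 0 L, u s + m * (y - s) ≤ u y) :
    ∃ w, IsPL w ∧ ∀ s ∈ Icc 0 L, u s = w s := by
  classical
  -- Two supporting lines of the same slope coincide, so one contact point for each slope that
  -- occurs is enough.
  set S := (Finset.Icc (-K) K).filter fun m : ℤ =>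
    ∃ s ∈ Icc 0 L, ∀ y ∈ Icc 0 L, u s + m * (y - s) ≤ u y with hS
  have key : ∀ m : ℤ, ∃ s, m ∈ S → s ∈ Icc 0 L ∧ ∀ y ∈ Icc 0 L, u s + m * (y - s) ≤ u y := by
    intro m
    by_cases hm : m ∈ S
    · obtain ⟨s, hs⟩ := (Finset.mem_filter.1 hm).2
      exact ⟨s, fun _ => hs⟩
    · exact ⟨0, fun h => absurd h hm⟩
  choose s hs using key
  have hmem : ∀ y ∈ Icc 0 L, ∃ m ∈ S, ∀ z ∈ Icc 0 L, u y + m * (z - y) ≤ u z := by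
    intro y hy
    obtain ⟨m, hm, H⟩ := h y hy
    exact ⟨m, Finset.mem_filter.2 ⟨hm, y, hy, H⟩, H⟩
  have hne : S.Nonempty := by
    obtain ⟨m, hm, -⟩ := hmem 0 ⟨le_rfl, hL⟩
    exact ⟨m, hm⟩
  refine ⟨_, IsPL.sup' hne fun m _ => IsPL.affine m (u (s m) - m * s m), fun y hy => ?_⟩
  apply le_antisymm
  · obtain ⟨m, hm, H⟩ := hmem y hy
    refine le_trans ?_ (Finset.le_sup' (fun m : ℤ => (m : ℝ) * y + (u (s m) - m * s m)) hm)
    linarith [H _ (hs m hm).1]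
  · refine Finset.sup'_le hne _ fun m hm => ?_
    linarith [(hs m hm).2 y hy]

/-! ### Uniform bounds for functions of bounded order. -/

namespace MetricGraph

variable {V : Type u} {E : Type v} {Γ : MetricGraph V E}

/-- The end at which the edge arrives when it is left in the given direction. -/
def far (Γ : MetricGraph V E) (d : E × Bool) : V := if d.2 then Γ.tgt d.1 else Γ.src d.1

theorem room_vertex (w : V) (d : E × Bool) : Γ.room (Point.vertex w) d = Γ.len d.1 := by
  obtain ⟨e, b⟩ := d
  cases b <;> simp [room, start]

theorem path_vertex_len (w : V) (d : E × Bool) :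
    Γ.path (Point.vertex w) d (Γ.len d.1) = Point.vertex (Γ.far d) := by
  obtain ⟨e, b⟩ := d
  cases b <;> simp [path, start, far]

variable [Fintype E]

/-- `u` is a rational function of order at least `-B` everywhere, and at least `0` at the internal
points of the edges. -/
structure IsBounded (Γ : MetricGraph V E) (B : Γ.Point → ℝ) (u : Γ.Point → ℝ) : Prop where
  rational : Γ.IsRational u
  le_ord : ∀ p, -B p ≤ Γ.ord u p
  inner : ∀ e, ∀ t ∈ Ioo 0 (Γ.len e), 0 ≤ Γ.ord u (Γ.param e t)

namespace IsBounded

variable {B : Γ.Point → ℝ} {u : Γ.Point → ℝ}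

theorem convexOn (hu : Γ.IsBounded B u) (e : E) :
    ConvexOn ℝ (Icc 0 (Γ.len e)) fun t => u (Γ.param e t) := by
  refine convexOn_of_convexKink (hu.rational.isPL e).continuous.continuousOn fun t ht => ?_
  obtain ⟨m, hm⟩ := hu.rational.isPL e t true
  obtain ⟨n, hn⟩ := hu.rational.isPL e t false
  simp only [dirSign_true, one_mul] at hm
  simp only [dirSign_false, neg_one_mul, ← sub_eq_add_neg] at hn
  refine ⟨m, n, hm, hn, ?_⟩
  rw [← ord_param_of_germSlope ht hm hn]
  exact hu.inner e t ht

/-- A convex function lies above the continuation of its initial affine piece. -/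
theorem le_path (hu : Γ.IsBounded B u) {p : Γ.Point} {d : E × Bool} (hd : Γ.IsDir p d) {δ : ℝ}
    (h0 : 0 ≤ δ) (h1 : δ ≤ Γ.room p d) : u p + Γ.slope u p d * δ ≤ u (Γ.path p d δ) := by
  rcases h0.eq_or_lt with rfl | h0
  · simp [path_zero hd]
  obtain ⟨η, h2, h3, h4⟩ := ((eventually_nhdsGT_of_nhdsGE (hu.rational.germSlope hd)).and
    ((eventually_le_nhdsGT h0).and self_mem_nhdsWithin)).exists
  have h4 : 0 < η := h4
  set r := η / δ with hr
  have hrη : r * δ = η := div_mul_cancel₀ _ h0.ne'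
  have hr0 : 0 < r := div_pos h4 h0
  have hr1 : r ≤ 1 := (div_le_one h0).2 h3
  have hc := (hu.convexOn d.1).2 (start_mem hd) (start_add_mem hd h0.le h1)
    (sub_nonneg.2 hr1) hr0.le (by ring)
  simp only [smul_eq_mul] at hc
  have h5 : (1 - r) * Γ.start p d + r * (Γ.start p d + dirSign d.2 * δ) =
      Γ.start p d + dirSign d.2 * η := by rw [← hrη]; ring
  rw [h5, param_start hd] at hc
  change u (Γ.path p d η) ≤ (1 - r) * u p + r * u (Γ.path p d δ) at hc
  simp only [path_zero hd] at h2
  rw [h2, ← hrη] at hc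
  have h6 : r * (u p + Γ.slope u p d * δ) ≤ r * u (Γ.path p d δ) := by linarith
  exact le_of_mul_le_mul_left h6 hr0

theorem le_apply_up (hu : Γ.IsBounded B u) {e : E} {s y : ℝ} (h0 : 0 ≤ s) (h1 : s < Γ.len e)
    (hy : y ∈ Icc s (Γ.len e)) :
    u (Γ.param e s) + Γ.slope u (Γ.param e s) (e, true) * (y - s) ≤ u (Γ.param e y) := by
  obtain ⟨h2, h3⟩ := isDir_param_up h0 h1
  have := hu.le_path h2 (δ := y - s) (sub_nonneg.2 hy.1) (by simp [room, h3, hy.2])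
  simpa [path, h3] using this

theorem le_apply_down (hu : Γ.IsBounded B u) {e : E} {s y : ℝ} (h0 : 0 < s) (h1 : s ≤ Γ.len e)
    (hy : y ∈ Icc 0 s) :
    u (Γ.param e s) + Γ.slope u (Γ.param e s) (e, false) * (s - y) ≤ u (Γ.param e y) := by
  obtain ⟨h2, h3⟩ := isDir_param_down h0 h1
  have := hu.le_path h2 (δ := s - y) (sub_nonneg.2 hy.2) (by simp [room, h3, hy.1])
  simpa [path, h3] using this

end IsBounded

/-- The bound for the descent from a vertex whose value is maximal up to `A`. -/
noncomputable def descent (Γ : MetricGraph V E) (B : Γ.Point → ℝ) (w : V) (A : ℝ) : ℝ :=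
  |B (Point.vertex w)| + ∑ d : E × Bool, A / Γ.len d.1

namespace IsBounded

variable {B : Γ.Point → ℝ} {u : Γ.Point → ℝ}

/-- By convexity a slope out of w is at most the mean slope to the far vertex, hence at most A
divided by the length. Since the slopes sum to at least -B(w), no single one can be very negative.
-/
theorem neg_descent_le_slope (hu : Γ.IsBounded B u) {w : V} {A : ℝ} (hA : 0 ≤ A)
    (hmax : ∀ q, u (Point.vertex q) ≤ u (Point.vertex w) + A) {d : E × Bool}
    (hd : Γ.IsDir (Point.vertex w) d) : -Γ.descent B w A ≤ Γ.slope u (Point.vertex w) d := by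
  classical
  have hle : ∀ d', Γ.IsDir (Point.vertex w) d' →
      (Γ.slope u (Point.vertex w) d' : ℝ) ≤ A / Γ.len d'.1 := by
    intro d' hd'
    rw [le_div_iff₀ (Γ.len_pos d'.1)]
    have := hu.le_path hd' (Γ.len_pos d'.1).le (room_vertex w d').ge
    rw [path_vertex_len] at this
    linarith [hmax (Γ.far d')]
  have hnn : ∀ d' : E × Bool, 0 ≤ A / Γ.len d'.1 := fun d' => div_nonneg hA (Γ.len_pos d'.1).le
  have hord := hu.le_ord (Point.vertex w)
  rw [hu.rational.ord_eq, ← Finset.add_sum_erase _ _ ((mem_dirs Γ).2 hd)] at hord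
  push_cast at hord
  have h1 : ∑ d' ∈ (Γ.dirs (Point.vertex w)).erase d, (Γ.slope u (Point.vertex w) d' : ℝ) ≤
      ∑ d' : E × Bool, A / Γ.len d'.1 :=
    (Finset.sum_le_sum fun d' hd' => hle d' ((mem_dirs Γ).1 (Finset.mem_of_mem_erase hd'))).trans
      (Finset.sum_le_sum_of_subset_of_nonneg (Finset.subset_univ _) fun d' _ _ => hnn d')
  rw [descent]
  linarith [le_abs_self (B (Point.vertex w))]

end IsBounded

/-- If the value at the vertex `p` is nearly maximal then so is the value at `q`, uniformly for all
functions bounded by `B`. -/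
def Controls (Γ : MetricGraph V E) (B : Γ.Point → ℝ) (p q : V) : Prop :=
  ∀ A : ℝ, 0 ≤ A → ∃ C : ℝ, 0 ≤ C ∧ ∀ u, Γ.IsBounded B u → ∀ M,
    (∀ w, u (Point.vertex w) ≤ M) → M - A ≤ u (Point.vertex p) → M - C ≤ u (Point.vertex q)

theorem controls_far {B : Γ.Point → ℝ} {p : V} {d : E × Bool} (hd : Γ.IsDir (Point.vertex p) d) :
    Γ.Controls B p (Γ.far d) := by
  intro A hA
  have hκ : 0 ≤ Γ.descent B p A := add_nonneg (abs_nonneg _)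
    (Finset.sum_nonneg fun d _ => div_nonneg hA (Γ.len_pos d.1).le)
  have hlen := (Γ.len_pos d.1).le
  refine ⟨A + Γ.descent B p A * Γ.len d.1, by positivity, fun u hu M hM hp => ?_⟩
  have h1 := hu.neg_descent_le_slope hA (fun q => (hM q).trans (by linarith)) hd
  have h2 := hu.le_path hd hlen (room_vertex p d).ge
  rw [path_vertex_len] at h2
  nlinarith

theorem controls (B : Γ.Point → ℝ) (p q : V) : Γ.Controls B p q := by
  have h := Γ.connected p q
  -- The walk may traverse edges against their orientation, so the induction needs the symmetric
  -- statement.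
  suffices Γ.Controls B p q ∧ Γ.Controls B q p from this.1
  induction h with
  | rel x y h =>
    obtain ⟨e, rfl, rfl⟩ := h
    exact ⟨controls_far (d := (e, true)) rfl, controls_far (d := (e, false)) rfl⟩
  | refl x =>
    have : Γ.Controls B x x := fun A hA => ⟨A, hA, fun u _ M _ h => h⟩
    exact ⟨this, this⟩
  | symm x y _ ih => exact ih.symm
  | trans x y z _ _ ih₁ ih₂ =>
    have key : ∀ {x y z}, Γ.Controls B x y → Γ.Controls B y z → Γ.Controls B x z := by
      intro x y z h₁ h₂ A hA
      obtain ⟨C₁, hC₁, H₁⟩ := h₁ A hA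
      obtain ⟨C₂, hC₂, H₂⟩ := h₂ C₁ hC₁
      exact ⟨C₂, hC₂, fun u hu M hM h => H₂ u hu M hM (H₁ u hu M hM h)⟩
    exact ⟨key ih₁.1 ih₂.1, key ih₂.2 ih₁.2⟩

/-- Start from a vertex of maximal value, where the defect is 0, and propagate to all others;
summing over pairs makes the constant independent of that vertex. -/
theorem exists_vertex_bound [Finite V] [Nonempty V] (B : Γ.Point → ℝ) :
    ∃ C : ℝ, 0 ≤ C ∧ ∀ u, Γ.IsBounded B u → ∀ p q : V,
      u (Point.vertex p) ≤ u (Point.vertex q) + C := by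
  have := Fintype.ofFinite V
  choose C hC0 hC using fun p q : V => controls B p q 0 le_rfl
  refine ⟨∑ x : V × V, C x.1 x.2, Finset.sum_nonneg fun x _ => hC0 x.1 x.2, fun u hu p q => ?_⟩
  obtain ⟨w, hw⟩ := Finite.exists_max fun w : V => u (Point.vertex w)
  have h1 := hC w q u hu _ hw (by simp)
  have h2 : C w q ≤ ∑ x : V × V, C x.1 x.2 :=
    Finset.single_le_sum (f := fun x : V × V => C x.1 x.2) (fun x _ => hC0 x.1 x.2)
      (Finset.mem_univ (w, q))
  linarith [hw p]

theorem exists_slope_bound [Finite V] [Nonempty V] (B : Γ.Point → ℝ) :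
    ∃ K : ℤ, ∀ u, Γ.IsBounded B u → ∀ w d, Γ.IsDir (Point.vertex w) d →
      -K ≤ Γ.slope u (Point.vertex w) d := by
  have := Fintype.ofFinite V
  obtain ⟨C, hC0, hC⟩ := exists_vertex_bound B
  have hκ : ∀ w, 0 ≤ Γ.descent B w C := fun w => add_nonneg (abs_nonneg _)
    (Finset.sum_nonneg fun d _ => div_nonneg hC0 (Γ.len_pos d.1).le)
  obtain ⟨n, hn⟩ := exists_nat_ge (∑ w : V, Γ.descent B w C)
  refine ⟨n, fun u hu w d hd => ?_⟩
  have h1 := hu.neg_descent_le_slope hC0 (fun q => hC u hu q w) hd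
  have h2 : Γ.descent B w C ≤ ∑ w : V, Γ.descent B w C :=
    Finset.single_le_sum (fun w _ => hκ w) (Finset.mem_univ w)
  have h3 : (-(n : ℤ) : ℝ) ≤ Γ.slope u (Point.vertex w) d := by push_cast; linarith
  exact_mod_cast h3

/-- A one-sided slope at s, read in the direction of increasing parameters, is an integral
subgradient. Comparison with the lines of slope -K and K through the two ends confines it to [-K,
K]. -/
theorem IsBounded.exists_subgradient {B : Γ.Point → ℝ} {u : Γ.Point → ℝ} (hu : Γ.IsBounded B u)
    {K : ℤ} (hK : ∀ w d, Γ.IsDir (Point.vertex w) d → -K ≤ Γ.slope u (Point.vertex w) d)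
    {e : E} {s : ℝ} (hs : s ∈ Icc 0 (Γ.len e)) : ∃ m ∈ Finset.Icc (-K) K,
      ∀ y ∈ Icc 0 (Γ.len e), u (Γ.param e s) + m * (y - s) ≤ u (Γ.param e y) := by
  have hL := Γ.len_pos e
  have ha := hK (Γ.src e) (e, true) rfl
  have hb := hK (Γ.tgt e) (e, false) rfl
  have hA : ∀ y ∈ Icc 0 (Γ.len e), u (Γ.param e 0) + (-K : ℤ) * y ≤ u (Γ.param e y) := by
    intro y hy
    have h1 := hu.le_apply_up le_rfl hL hy
    have h2 : ((-K : ℤ) : ℝ) ≤ Γ.slope u (Γ.param e 0) (e, true) := by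
      rw [param_zero]; exact_mod_cast ha
    nlinarith [hy.1]
  have hB : ∀ y ∈ Icc 0 (Γ.len e),
      u (Γ.param e (Γ.len e)) + (-K : ℤ) * (Γ.len e - y) ≤ u (Γ.param e y) := by
    intro y hy
    have h1 := hu.le_apply_down hL le_rfl hy
    have h2 : ((-K : ℤ) : ℝ) ≤ Γ.slope u (Γ.param e (Γ.len e)) (e, false) := by
      rw [param_len]; exact_mod_cast hb
    nlinarith [hy.2]
  have key : ∃ m : ℤ, (s = 0 → -K ≤ m) ∧ (s = Γ.len e → m ≤ K) ∧
      ∀ y ∈ Icc 0 (Γ.len e), u (Γ.param e s) + m * (y - s) ≤ u (Γ.param e y) := by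
    rcases hs.2.eq_or_lt with rfl | h1
    · refine ⟨-Γ.slope u (Γ.param e (Γ.len e)) (e, false), fun h => absurd h hL.ne', fun _ => ?_,
        fun y hy => ?_⟩
      · rw [param_len]; linarith
      · have := hu.le_apply_down hL le_rfl hy
        push_cast
        linarith
    · refine ⟨Γ.slope u (Γ.param e s) (e, true), fun h => ?_, fun h => absurd h h1.ne,
        fun y hy => ?_⟩
      · rw [h, param_zero]; exact ha
      rcases le_or_gt s y with h2 | h2
      · exact hu.le_apply_up hs.1 h1 ⟨h2, hy.2⟩
      · have h0 : 0 < s := hy.1.trans_lt h2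
        have h3 := hu.le_apply_down h0 hs.2 ⟨hy.1, h2.le⟩
        obtain ⟨d1, e1⟩ := isDir_param_up hs.1 h1
        obtain ⟨d2, e2⟩ := isDir_param_down h0 hs.2
        have g1 := hu.rational.germSlope d1
        have g2 := hu.rational.germSlope d2
        simp only [path, e1, e2, dirSign_true, dirSign_false, one_mul, neg_one_mul,
          ← sub_eq_add_neg] at g1 g2
        have h4 := hu.inner e s ⟨h0, h1⟩
        rw [ord_param_of_germSlope ⟨h0, h1⟩ g1 g2] at h4
        nlinarith
  obtain ⟨m, hm0, hm1, hm⟩ := key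
  refine ⟨m, Finset.mem_Icc.2 ⟨?_, ?_⟩, hm⟩
  · rcases hs.1.eq_or_lt with h | h
    · exact hm0 h.symm
    · have h1 := hm 0 ⟨le_rfl, hL.le⟩
      have h2 := hA s hs
      have h3 : ((-K : ℤ) : ℝ) * s ≤ m * s := by linarith
      exact_mod_cast le_of_mul_le_mul_right h3 h
  · rcases hs.2.eq_or_lt with h | h
    · exact hm1 h
    · have h1 := hm _ ⟨hL.le, le_rfl⟩
      have h2 := hB s hs
      push_cast at h2
      have h3 : (m : ℝ) * (Γ.len e - s) ≤ K * (Γ.len e - s) := by linarith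
      exact_mod_cast le_of_mul_le_mul_right h3 (sub_pos.2 h)

/-- A rational function bounded by `B` varies by at most a constant that depends on `B` only. -/
theorem exists_bound [Finite V] [Nonempty V] (B : Γ.Point → ℝ) (v₀ : Γ.Point) :
    ∃ C : ℝ, ∀ u, Γ.IsBounded B u → ∀ x, u x ≤ u v₀ + C := by
  obtain ⟨C, hC0, hC⟩ := exists_vertex_bound B
  obtain ⟨K, hK⟩ := exists_slope_bound B
  have h1 : ∃ C' : ℝ, ∃ w : V, ∀ u, Γ.IsBounded B u → u (Point.vertex w) ≤ u v₀ + C' := by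
    rcases v₀ with w | ⟨e, t, ht⟩
    · exact ⟨0, w, fun u _ => by simp⟩
    · refine ⟨K * t, Γ.src e, fun u hu => ?_⟩
      have h2 := hu.le_apply_up le_rfl (Γ.len_pos e) (Ioo_subset_Icc_self ht)
      have h3 : ((-K : ℤ) : ℝ) ≤ Γ.slope u (Point.vertex (Γ.src e)) (e, true) := by
        exact_mod_cast hK u hu (Γ.src e) (e, true) rfl
      rw [param_zero, param_inner ht, sub_zero] at h2
      push_cast at h3
      nlinarith [ht.1]
  obtain ⟨C', w, hw⟩ := h1
  refine ⟨C + C', fun u hu x => ?_⟩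
  have h2 : ∀ q, u (Point.vertex q) ≤ u v₀ + (C + C') := fun q => by
    linarith [hC u hu q w, hw u hu]
  rcases x with q | ⟨e, t, ht⟩
  · exact h2 q
  · have hL := (Γ.len_pos e).le
    have h3 := (hu.convexOn e).le_max_of_mem_Icc ⟨le_rfl, hL⟩ ⟨hL, le_rfl⟩
      (Ioo_subset_Icc_self ht)
    simp only [param_zero, param_len, param_inner ht] at h3
    exact h3.trans (max_le (h2 _) (h2 _))

/-! ### The greatest function of bounded order. -/

/-- Among the rational functions bounded by `B` with a given value at `v₀`, there is a largest. -/
theorem exists_greatest [Finite V] (B : Γ.Point → ℝ) (v₀ : Γ.Point) {φ : Γ.Point → ℝ}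
    (hφ : Γ.IsBounded B φ) : ∃ F, Γ.IsBounded B F ∧ F v₀ = φ v₀ ∧
      ∀ u, Γ.IsBounded B u → u v₀ = φ v₀ → u ≤ F := by
  have : Nonempty V := by
    rcases v₀ with w | ⟨e, t⟩
    exacts [⟨w⟩, ⟨Γ.src e⟩]
  obtain ⟨C, hC⟩ := exists_bound B v₀
  obtain ⟨K, hK⟩ := exists_slope_bound B
  set U := {u : Γ.Point → ℝ // Γ.IsBounded B u ∧ u v₀ = φ v₀}
  have : Nonempty U := ⟨⟨φ, hφ, rfl⟩⟩
  have hbdd : ∀ x, BddAbove (range fun u : U => u.1 x) := by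
    intro x
    refine ⟨φ v₀ + C, ?_⟩
    rintro _ ⟨u, rfl⟩
    exact (hC u.1 u.2.1 x).trans (by rw [u.2.2])
  set F : Γ.Point → ℝ := fun x => ⨆ u : U, u.1 x with hF
  have hle : ∀ (u : U) x, u.1 x ≤ F x := fun u x => le_ciSup (hbdd x) u
  have hlt : ∀ x η, 0 < η → ∃ u : U, F x - η < u.1 x := fun x η hη =>
    exists_lt_of_lt_ciSup (sub_lt_self _ hη)
  have hrat : Γ.IsRational F := by
    refine isRational_of_edges fun e => exists_isPL_of_subgradients (u := fun t => F (Γ.param e t))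
      (Γ.len_pos e).le (K := K) fun s hs => ?_
    -- If each of the finitely many slopes fails for F at s by some margin, a competitor closer to F
    -- at s than all margins has no subgradient there either.
    by_contra hcon
    push Not at hcon
    choose! y hy hylt using hcon
    have hev : ∀ᶠ η in 𝓝[>] (0 : ℝ), ∀ m ∈ Finset.Icc (-K) K,
        η ≤ F (Γ.param e s) + m * (y m - s) - F (Γ.param e (y m)) := by
      rw [Filter.eventually_all_finset]
      exact fun m hm => eventually_le_nhdsGT (sub_pos.2 (hylt m hm))
    obtain ⟨η, h1, h2⟩ := (hev.and self_mem_nhdsWithin).exists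
    obtain ⟨u, hu⟩ := hlt (Γ.param e s) η h2
    obtain ⟨m, hm, hsub⟩ := u.2.1.exists_subgradient (hK u.1 u.2.1) hs
    linarith [h1 m hm, hsub _ (hy m hm), hle u (Γ.param e (y m))]
  -- Let F be affine up to δ in every direction at p and let u(p) > F(p) - δ. Since u ≤ F at
  -- distance δ, convexity makes each slope of u less than that of F plus 1, so by integrality at
  -- most that of F.
  have hord : ∀ p, ∃ u : U, Γ.ord u.1 p ≤ Γ.ord F p := by
    intro p
    have hev : ∀ᶠ δ in 𝓝[>] (0 : ℝ), ∀ d ∈ Γ.dirs p,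
        F (Γ.path p d δ) = F p + Γ.slope F p d * δ ∧ δ ≤ Γ.room p d := by
      rw [Filter.eventually_all_finset]
      intro d hd
      rw [mem_dirs] at hd
      have := hrat.germSlope hd
      rw [GermSlope, path_zero hd] at this
      exact (eventually_nhdsGT_of_nhdsGE this).and (eventually_le_nhdsGT (room_pos hd))
    obtain ⟨δ, h1, h2⟩ := (hev.and self_mem_nhdsWithin).exists
    have h2 : 0 < δ := h2
    obtain ⟨u, hu⟩ := hlt p δ h2
    refine ⟨u, ?_⟩
    rw [u.2.1.rational.ord_eq, hrat.ord_eq]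
    have : ∑ d ∈ Γ.dirs p, Γ.slope u.1 p d ≤ ∑ d ∈ Γ.dirs p, Γ.slope F p d := by
      refine Finset.sum_le_sum fun d hd => ?_
      obtain ⟨h3, h4⟩ := h1 d hd
      have h5 := u.2.1.le_path ((mem_dirs Γ).1 hd) h2.le h4
      have h6 := hle u (Γ.path p d δ)
      have h7 : (Γ.slope u.1 p d : ℝ) * δ < (Γ.slope F p d + 1) * δ := by linarith
      have h8 : (Γ.slope u.1 p d : ℝ) < Γ.slope F p d + 1 := lt_of_mul_lt_mul_right h7 h2.le
      exact Int.lt_add_one_iff.1 (by exact_mod_cast h8)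
    exact_mod_cast this
  refine ⟨F, ⟨hrat, fun p => ?_, fun e t ht => ?_⟩, ?_, fun u hu h => hle ⟨u, hu, h⟩⟩
  · obtain ⟨u, hu⟩ := hord p
    exact (u.2.1.le_ord p).trans hu
  · obtain ⟨u, hu⟩ := hord (Γ.param e t)
    exact (u.2.1.inner e t ht).trans hu
  · simp only [hF, fun u : U => u.2.2, ciSup_const]

end MetricGraph

/-! ### Bumps, and firing a closed connected set. -/

/-- `u` is a piecewise affine bump of height `ε` on `T` that descends with slope `1` outside `T`. -/
structure IsBump (T : Set ℝ) (ε : ℝ) (u : ℝ → ℝ) : Prop where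
  isPL : IsPL u
  nonneg : ∀ s, 0 ≤ u s
  le : ∀ s, u s ≤ ε
  eq_of_mem : ∀ s ∈ T, u s = ε
  eq_zero : ∀ s, (∀ t ∈ T, ε ≤ |s - t|) → u s = 0
  sub_le : ∀ s, ∀ t ∈ T, ε - |s - t| ≤ u s
  kink : ∀ s, s ∉ T → ConvexKink u s

namespace IsBump

variable {ε : ℝ}

theorem empty (hε : 0 ≤ ε) : IsBump ∅ ε fun _ => 0 where
  isPL := .const 0
  nonneg _ := le_rfl
  le _ := hε
  eq_of_mem _ h := h.elim
  eq_zero _ _ := rfl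
  sub_le _ _ h := h.elim
  kink _ _ := .const 0

theorem union {T T' : Set ℝ} {u u' : ℝ → ℝ} (h : IsBump T ε u) (h' : IsBump T' ε u') :
    IsBump (T ∪ T') ε fun s => max (u s) (u' s) where
  isPL := h.isPL.max h'.isPL
  nonneg s := le_max_of_le_left (h.nonneg s)
  le s := max_le (h.le s) (h'.le s)
  eq_of_mem s hs := by
    rcases hs with hs | hs
    · rw [h.eq_of_mem s hs, max_eq_left (h'.le s)]
    · rw [h'.eq_of_mem s hs, max_eq_right (h.le s)]
  eq_zero s hs := by
    rw [h.eq_zero s fun t ht => hs t (Or.inl ht), h'.eq_zero s fun t ht => hs t (Or.inr ht),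
      max_self]
  sub_le s t ht := by
    rcases ht with ht | ht
    · exact le_max_of_le_left (h.sub_le s t ht)
    · exact le_max_of_le_right (h'.sub_le s t ht)
  kink s hs := (h.kink s fun h => hs (Or.inl h)).max (h'.kink s fun h => hs (Or.inr h))

theorem interval (hε : 0 < ε) {a b : ℝ} (hab : a ≤ b) :
    IsBump (Icc a b) ε fun s => max 0 (min ε (min (ε - (a - s)) (ε - (s - b)))) where
  isPL := by
    refine (IsPL.const 0).max ((IsPL.const ε).min (IsPL.min ?_ ?_))
    · convert IsPL.affine 1 (ε - a) using 2
      push_cast; ring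
    · convert IsPL.affine (-1) (ε + b) using 2
      push_cast; ring
  nonneg s := le_max_left _ _
  le s := max_le hε.le (min_le_left _ _)
  eq_of_mem s hs := by
    rw [min_eq_left (le_min (by linarith [hs.1]) (by linarith [hs.2])), max_eq_right hε.le]
  eq_zero s hs := by
    refine max_eq_left ?_
    rcases lt_or_ge s a with h | h
    · have := hs a ⟨le_rfl, hab⟩
      rw [abs_of_neg (by linarith)] at this
      exact (min_le_right _ _).trans ((min_le_left _ _).trans (by linarith))
    rcases lt_or_ge b s with h' | h'
    · have := hs b ⟨hab, le_rfl⟩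
      rw [abs_of_pos (by linarith)] at this
      exact (min_le_right _ _).trans ((min_le_right _ _).trans (by linarith))
    · have := hs s ⟨h, h'⟩
      simp at this
      linarith
  sub_le s t ht := by
    refine le_max_of_le_right (le_min ?_ (le_min ?_ ?_))
    · linarith [abs_nonneg (s - t)]
    · linarith [neg_abs_le (s - t), ht.1]
    · linarith [le_abs_self (s - t), ht.2]
  kink s hs := by
    rcases lt_or_ge s a with h | h
    · refine ((ConvexKink.const 0).max (ConvexKink.affine 1 (ε - a))).congr ?_
      filter_upwards [gt_mem_nhds h] with x hx
      rw [min_eq_left (b := ε - (x - b)) (by linarith), min_eq_right (by linarith)]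
      ring_nf
    · have h' : b < s := not_le.1 fun h' => hs ⟨h, h'⟩
      refine ((ConvexKink.const 0).max (ConvexKink.affine (-1) (ε + b))).congr ?_
      filter_upwards [lt_mem_nhds h'] with x hx
      rw [min_eq_right (a := ε - (a - x)) (by linarith), min_eq_right (by linarith)]
      ring_nf

theorem exists_of_ordConnected (hε : 0 < ε) {T : Set ℝ} (hT : IsCompact T) (hT' : T.OrdConnected) :
    ∃ u, IsBump T ε u := by
  rcases T.eq_empty_or_nonempty with rfl | hne
  · exact ⟨_, empty hε.le⟩
  · have h := eq_Icc_of_connected_compact ⟨hne, hT'.isPreconnected⟩ hT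
    have hle : sInf T ≤ sSup T := csInf_le_csSup hne hT.bddBelow hT.bddAbove
    rw [h]
    exact ⟨_, interval hε hle⟩

end IsBump

namespace MetricGraph

variable {V : Type u} {E : Type v} {Γ : MetricGraph V E}

/-- A connected closed set that meets an open interval of an edge, but does not contain the ends
of the interval, lies in the interval. -/
theorem mem_Ioo_of_isPreconnected {X : Set Γ.Point} (hX : IsClosed X) (hX' : IsPreconnected X)
    {e : E} {a b c t : ℝ} (ha : 0 ≤ a) (hab : a < b) (hbc : b < c) (hc : c ≤ Γ.len e)
    (haX : Γ.param e a ∉ X) (hbX : Γ.param e b ∈ X) (hcX : Γ.param e c ∉ X)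
    (ht : t ∈ Icc 0 (Γ.len e)) (htX : Γ.param e t ∈ X) : t ∈ Ioo a c := by
  classical
  by_contra hcon
  set w : ℝ → ℝ := fun s => max 0 (min (s - a) (c - s)) with hw
  have hwPL : IsPL w := by
    refine (IsPL.const 0).max (IsPL.min ?_ ?_)
    · convert IsPL.affine 1 (-a) using 2
      push_cast; ring
    · convert IsPL.affine (-1) c using 2
      push_cast; ring
  set u : E → ℝ → ℝ := fun e' => if e' = e then w else fun _ => 0 with hu
  have h0 : ∀ e', u e' 0 = (fun _ : V => (0 : ℝ)) (Γ.src e') := by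
    intro e'
    by_cases h : e' = e
    · simp [hu, h, hw, ha]
    · simp [hu, h]
  have h1 : ∀ e', u e' (Γ.len e') = (fun _ : V => (0 : ℝ)) (Γ.tgt e') := by
    intro e'
    by_cases h : e' = e
    · subst h; simp [hu, hw, hc]
    · simp [hu, h]
  have hrat : Γ.IsRational (Γ.glue (fun _ => 0) u) := isRational_glue h0 h1 fun e' => by
    by_cases h : e' = e
    · simpa [hu, h] using hwPL
    · simpa [hu, h] using IsPL.const 0
  set κ := Γ.glue (fun _ => 0) u with hκ
  have hκe : ∀ s ∈ Icc 0 (Γ.len e), κ (Γ.param e s) = w s := by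
    intro s hs
    rw [hκ, glue_param h0 h1 hs]
    simp [hu]
  have hopen : IsOpen (Γ.param e ⁻¹' Xᶜ) := hX.isOpen_compl.preimage (continuous_param e)
  obtain ⟨η₁, hη₁, H₁⟩ := Metric.isOpen_iff.1 hopen a haX
  obtain ⟨η₂, hη₂, H₂⟩ := Metric.isOpen_iff.1 hopen c hcX
  have hb : 0 < κ (Γ.param e b) := by
    rw [hκe b ⟨by linarith, by linarith⟩]
    exact lt_max_of_lt_right (lt_min (by linarith) (by linarith))
  have ht0 : κ (Γ.param e t) ≤ 0 := by
    rw [hκe t ht]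
    refine max_le le_rfl ?_
    by_contra h
    obtain ⟨h2, h3⟩ := lt_min_iff.1 (not_le.1 h)
    exact hcon ⟨by linarith, by linarith⟩
  have hη : 0 < min η₁ η₂ := lt_min hη₁ hη₂
  -- X stays away from both ends of (a, c), so the tent κ takes no value strictly between 0 and the
  -- smaller distance on X. Connectedness forbids both 0 and positive values.
  obtain ⟨x, hxX, hx0, hx1⟩ := hX' {x | 0 < κ x} {x | κ x < min η₁ η₂}
    (isOpen_lt continuous_const hrat.continuous) (isOpen_lt hrat.continuous continuous_const)
    (fun x _ => (lt_or_ge 0 (κ x)).imp id fun h => h.trans_lt hη)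
    ⟨_, hbX, hb⟩ ⟨_, htX, ht0.trans_lt hη⟩
  simp only [mem_ofPred_eq] at hx0 hx1
  rcases x with q | ⟨e', s, hs⟩
  · exact absurd hx0 (lt_irrefl _)
  by_cases h : e' = e
  · subst h
    rw [← param_inner hs, hκe s (Ioo_subset_Icc_self hs)] at hx0 hx1
    rw [← param_inner hs] at hxX
    have h2 : 0 < min (s - a) (c - s) := by
      rcases lt_max_iff.1 hx0 with h | h
      · exact absurd h (lt_irrefl _)
      · exact h
    obtain ⟨h3, h4⟩ := lt_min_iff.1 h2
    have h5 : min (s - a) (c - s) < min η₁ η₂ := (le_max_right _ _).trans_lt hx1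
    rcases min_lt_iff.1 h5 with h6 | h6
    · refine H₁ ?_ hxX
      rw [Metric.mem_ball, Real.dist_eq, abs_of_pos h3]
      exact h6.trans_le (min_le_left _ _)
    · refine H₂ ?_ hxX
      rw [Metric.mem_ball, Real.dist_eq, abs_sub_comm, abs_of_pos h4]
      exact h6.trans_le (min_le_right _ _)
  · simp [hκ, glue, hu, h] at hx0

/-- The parameters of the points of `X` on the edge `e`. -/
def edgeTrace (Γ : MetricGraph V E) (X : Set Γ.Point) (e : E) : Set ℝ :=
  Icc 0 (Γ.len e) ∩ Γ.param e ⁻¹' X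

theorem isCompact_edgeTrace {X : Set Γ.Point} (hX : IsClosed X) (e : E) :
    IsCompact (Γ.edgeTrace X e) :=
  isCompact_Icc.inter_right (hX.preimage (continuous_param e))

/-- A connected set meets an edge in the whole edge or, cut at a missing point x, in at most one
interval on either side of x. So finitely many pieces suffice. -/
theorem exists_isBump_edgeTrace {X : Set Γ.Point} (hX : IsClosed X) (hX' : IsPreconnected X) {ε : ℝ}
    (hε : 0 < ε) (e : E) : ∃ u, IsBump (Γ.edgeTrace X e) ε u := by
  by_cases hall : ∀ x ∈ Icc 0 (Γ.len e), Γ.param e x ∈ X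
  · have : Γ.edgeTrace X e = Icc 0 (Γ.len e) := inter_eq_left.2 hall
    rw [this]
    exact ⟨_, IsBump.interval hε (Γ.len_pos e).le⟩
  push Not at hall
  obtain ⟨x, hx, hxX⟩ := hall
  have hT : Γ.edgeTrace X e =
      (Γ.edgeTrace X e ∩ Icc 0 x) ∪ (Γ.edgeTrace X e ∩ Icc x (Γ.len e)) := by
    rw [← inter_union_distrib_left, Icc_union_Icc_eq_Icc hx.1 hx.2]
    exact (inter_eq_left.2 inter_subset_left).symm
  have hc := isCompact_edgeTrace hX e
  have hord₁ : (Γ.edgeTrace X e ∩ Icc 0 x).OrdConnected := by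
    refine ⟨fun s₁ h₁ s₃ h₃ s₂ h₂ => ?_⟩
    have hs₂ : s₂ ∈ Icc 0 x := ⟨h₁.2.1.trans h₂.1, h₂.2.trans h₃.2.2⟩
    refine ⟨⟨⟨hs₂.1, hs₂.2.trans hx.2⟩, ?_⟩, hs₂⟩
    by_contra h
    have h4 : s₂ < s₃ := lt_of_le_of_ne h₂.2 (by rintro rfl; exact h h₃.1.2)
    have h5 : s₃ < x := lt_of_le_of_ne h₃.2.2 (by rintro rfl; exact hxX h₃.1.2)
    have := mem_Ioo_of_isPreconnected hX hX' hs₂.1 h4 h5 hx.2 h h₃.1.2 hxX h₁.1.1 h₁.1.2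
    exact absurd this.1 (not_lt.2 h₂.1)
  have hord₂ : (Γ.edgeTrace X e ∩ Icc x (Γ.len e)).OrdConnected := by
    refine ⟨fun s₁ h₁ s₃ h₃ s₂ h₂ => ?_⟩
    have hs₂ : s₂ ∈ Icc x (Γ.len e) := ⟨h₁.2.1.trans h₂.1, h₂.2.trans h₃.2.2⟩
    refine ⟨⟨⟨hx.1.trans hs₂.1, hs₂.2⟩, ?_⟩, hs₂⟩
    by_contra h
    have h4 : s₁ < s₂ := lt_of_le_of_ne h₂.1 (by rintro rfl; exact h h₁.1.2)
    have h5 : x < s₁ := lt_of_le_of_ne h₁.2.1 (by rintro rfl; exact hxX h₁.1.2)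
    have := mem_Ioo_of_isPreconnected hX hX' hx.1 h5 h4 hs₂.2 hxX h₁.1.2 h h₃.1.1 h₃.1.2
    exact absurd this.2 (not_lt.2 h₂.2)
  obtain ⟨u₁, hu₁⟩ := IsBump.exists_of_ordConnected hε (hc.inter_right isClosed_Icc) hord₁
  obtain ⟨u₂, hu₂⟩ := IsBump.exists_of_ordConnected hε (hc.inter_right isClosed_Icc) hord₂
  rw [hT]
  exact ⟨_, hu₁.union hu₂⟩

theorem eventually_le_dist_edgeTrace {X : Set Γ.Point} (hX : IsClosed X) (e : E) (s : ℝ) :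
    ∀ᶠ ε in 𝓝[>] (0 : ℝ), Γ.param e s ∉ X → ∀ t ∈ Γ.edgeTrace X e, ε ≤ |s - t| := by
  by_cases hs : Γ.param e s ∈ X
  · exact Eventually.of_forall fun ε h => absurd hs h
  · have hopen : IsOpen (Γ.param e ⁻¹' Xᶜ) := hX.isOpen_compl.preimage (continuous_param e)
    obtain ⟨η, hη, H⟩ := Metric.isOpen_iff.1 hopen s hs
    filter_upwards [eventually_le_nhdsGT hη] with ε hε _ t ht
    by_contra h
    refine H ?_ ht.2
    rw [Metric.mem_ball, Real.dist_eq, abs_sub_comm]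
    linarith

variable [Fintype E]

/-- The rational function that fires a connected closed set by a small amount. -/
theorem exists_firing {X : Set Γ.Point} (hX : IsClosed X) (hX' : IsPreconnected X) {v₀ : Γ.Point}
    (hv₀ : v₀ ∉ X) : ∃ g, Γ.IsRational g ∧ g v₀ = 0 ∧ (∀ p ∈ X, 0 < g p) ∧
      (∀ p ∉ frontier X, 0 ≤ Γ.ord g p) ∧ ∀ p ∈ X, -(Γ.leaving X p : ℝ) ≤ Γ.ord g p := by
  classical
  -- With ε this small the bumps vanish at edge ends outside X, so that they glue, and at v₀. When
  -- v₀ is internal, its parameter is imposed on the other edges as well, which is harmless.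
  have hev : ∀ᶠ ε in 𝓝[>] (0 : ℝ), ∀ e, ∀ s ∈ ({0, Γ.len e, Γ.start v₀ (e, true)} : Finset ℝ),
      Γ.param e s ∉ X → ∀ t ∈ Γ.edgeTrace X e, ε ≤ |s - t| := by
    refine eventually_all.2 fun e => (Filter.eventually_all_finset _).2 fun s _ => ?_
    exact eventually_le_dist_edgeTrace hX e s
  obtain ⟨ε, hεX, hε⟩ := (hev.and self_mem_nhdsWithin).exists
  have hε : 0 < ε := hε
  choose u hu using exists_isBump_edgeTrace hX hX' hε
  set c : V → ℝ := fun w => if Point.vertex w ∈ X then ε else 0 with hc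
  have h0 : ∀ e, u e 0 = c (Γ.src e) := by
    intro e
    have hmem : (0 : ℝ) ∈ Icc 0 (Γ.len e) := ⟨le_rfl, (Γ.len_pos e).le⟩
    simp only [hc, ← param_zero]
    split_ifs with h
    · exact (hu e).eq_of_mem 0 ⟨hmem, h⟩
    · exact (hu e).eq_zero 0 (hεX e 0 (by simp) h)
  have h1 : ∀ e, u e (Γ.len e) = c (Γ.tgt e) := by
    intro e
    have hmem : Γ.len e ∈ Icc 0 (Γ.len e) := ⟨(Γ.len_pos e).le, le_rfl⟩
    simp only [hc, ← param_len]
    split_ifs with h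
    · exact (hu e).eq_of_mem _ ⟨hmem, h⟩
    · exact (hu e).eq_zero _ (hεX e _ (by simp) h)
  have hrat : Γ.IsRational (Γ.glue c u) := isRational_glue h0 h1 fun e => (hu e).isPL
  have hnonneg : ∀ x, 0 ≤ Γ.glue c u x := by
    rintro (w | ⟨e, s⟩)
    · simp only [glue, hc]; split_ifs <;> simp [hε.le]
    · exact (hu e).nonneg s
  have hle : ∀ x, Γ.glue c u x ≤ ε := by
    rintro (w | ⟨e, s⟩)
    · simp only [glue, hc]; split_ifs <;> simp [hε.le]
    · exact (hu e).le s
  have hXε : ∀ x ∈ X, Γ.glue c u x = ε := by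
    rintro (w | ⟨e, s, hs⟩) hx
    · simp [glue, hc, hx]
    · exact (hu e).eq_of_mem s ⟨Ioo_subset_Icc_self hs, by rwa [mem_preimage, param_inner hs]⟩
  have hslope : ∀ p ∈ X, ∀ d, Γ.IsDir p d → -1 ≤ Γ.slope (Γ.glue c u) p d := by
    intro p hp d hd
    have hs : Γ.start p d ∈ Γ.edgeTrace X d.1 :=
      ⟨start_mem hd, by rwa [mem_preimage, param_start hd]⟩
    obtain ⟨δ, h2, h3, h4⟩ := ((eventually_nhdsGT_of_nhdsGE (hrat.germSlope hd)).and
      ((eventually_le_nhdsGT (room_pos hd)).and self_mem_nhdsWithin)).exists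
    have h4 : 0 < δ := h4
    simp only [path_zero hd, hXε p hp] at h2
    rw [path, glue_param h0 h1 (start_add_mem hd h4.le h3)] at h2
    have h5 := (hu d.1).sub_le (Γ.start p d + dirSign d.2 * δ) _ hs
    have h6 : |Γ.start p d + dirSign d.2 * δ - Γ.start p d| = δ := by
      rw [add_sub_cancel_left, abs_mul, abs_of_pos h4]
      rcases d with ⟨e, b⟩
      cases b <;> simp
    rw [h6] at h5
    have h7 : (-1 : ℝ) * δ ≤ Γ.slope (Γ.glue c u) p d * δ := by linarith
    exact_mod_cast le_of_mul_le_mul_right h7 h4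
  -- The function equals ε on X, so a negative slope forces the path out of X at once.
  have hleave : ∀ p ∈ X, ∀ d, Γ.IsDir p d → d ∉ Γ.leavingDirs X p →
      0 ≤ Γ.slope (Γ.glue c u) p d := by
    intro p hp d hd hdX
    by_contra hneg
    refine hdX (mem_leavingDirs.2 ⟨hd, ?_⟩)
    have hneg : (Γ.slope (Γ.glue c u) p d : ℝ) < 0 := by exact_mod_cast not_le.1 hneg
    filter_upwards [eventually_nhdsGT_of_nhdsGE (hrat.germSlope hd), self_mem_nhdsWithin]
      with δ h2 h3 h4
    have h3 : 0 < δ := h3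
    rw [path_zero hd, hXε p hp, hXε _ h4] at h2
    nlinarith
  have hordX : ∀ p ∈ X, -(Γ.leaving X p : ℝ) ≤ Γ.ord (Γ.glue c u) p := by
    intro p hp
    rw [leaving_eq, hrat.ord_eq]
    have h2 : ∑ d ∈ Γ.dirs p, (if d ∈ Γ.leavingDirs X p then (-1 : ℤ) else 0) ≤
        ∑ d ∈ Γ.dirs p, Γ.slope (Γ.glue c u) p d := by
      refine Finset.sum_le_sum fun d hd => ?_
      rw [mem_dirs] at hd
      split_ifs with h
      · exact hslope p hp d hd
      · exact hleave p hp d hd h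
    have h3 : Γ.dirs p ∩ Γ.leavingDirs X p = Γ.leavingDirs X p :=
      Finset.inter_eq_right.2 fun d hd => (mem_dirs Γ).2 (mem_leavingDirs.1 hd).1
    rw [Finset.sum_ite_mem, h3] at h2
    simp only [Finset.sum_const, mul_neg, mul_one, nsmul_eq_mul] at h2
    exact_mod_cast h2
  refine ⟨_, hrat, ?_, fun p hp => (hXε p hp).symm ▸ hε, fun p hp => ?_, hordX⟩
  · rcases v₀ with w | ⟨e, t, ht⟩
    · simp [glue, hc, hv₀]
    · refine (hu e).eq_zero t (hεX e t (by simp [start]) ?_)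
      rwa [param_inner ht]
  · by_cases hpX : p ∈ X
    · have hint : p ∈ interior X := by
        by_contra h
        exact hp (hX.frontier_eq ▸ ⟨hpX, h⟩)
      have hempty : Γ.leavingDirs X p = ∅ := by
        rw [Finset.eq_empty_iff_forall_notMem]
        intro d hd
        obtain ⟨hd, hd'⟩ := mem_leavingDirs.1 hd
        have htends : Tendsto (Γ.path p d) (𝓝[>] 0) (𝓝 p) := by
          have := ((continuous_path p d).tendsto 0).mono_left (nhdsWithin_le_nhds (s := Ioi 0))
          rwa [path_zero hd] at this
        obtain ⟨δ, h2, h3⟩ :=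
          (hd'.and (htends.eventually (mem_interior_iff_mem_nhds.1 hint))).exists
        exact h2 h3
      have := hordX p hpX
      rwa [leaving_eq, hempty, Finset.card_empty, Nat.cast_zero, neg_zero] at this
    · rcases p with w | ⟨e, s, hs⟩
      · refine (hrat.ord_nonneg_of_isMin fun x => ?_).2
        simpa [glue, hc, hpX] using hnonneg x
      · rw [← param_inner hs] at hpX ⊢
        exact ord_glue_nonneg h0 h1 hs ((hu e).kink s fun h => hpX h.2)

/-! ### Existence of the reduced divisor. -/

theorem exists_isReduced [Finite V] (v₀ : Γ.Point) (D : Γ.Divisor) :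
    ∃ D₀ : Γ.Divisor, Γ.IsReduced v₀ D₀ ∧ Γ.LinEquiv D₀ D := by
  obtain ⟨f₀, hf₀, hord₀⟩ := exists_le_ord v₀ (-D)
  obtain ⟨P₀, hP₀⟩ := hf₀.exists_divisor
  -- Being reduced does not restrict the coefficient at v₀; setting it to 0 makes D₁ effective
  -- everywhere, so that φ below is itself a competitor.
  set D₁ : Γ.Divisor := (D + P₀).erase v₀ with hD₁
  have hD₁ne : ∀ p, p ≠ v₀ → (D₁ p : ℝ) = D p + Γ.ord f₀ p := by
    intro p hp
    rw [hD₁, Finsupp.erase_ne hp, ← hP₀]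
    simp
  have hD₁pos : ∀ p, (0 : ℝ) ≤ D₁ p := by
    intro p
    by_cases hp : p = v₀
    · rw [hD₁, hp, Finsupp.erase_same, Int.cast_zero]
    · rw [hD₁ne p hp]
      have := hord₀ p hp
      simp only [Finsupp.neg_apply, Int.cast_neg] at this
      linarith
  obtain ⟨w⟩ : Nonempty V := by
    rcases v₀ with w | ⟨e, t⟩
    exacts [⟨w⟩, ⟨Γ.src e⟩]
  obtain ⟨φ, hφ, hordφ⟩ := exists_le_ord (Point.vertex w) D₁
  -- For F = φ + h, the condition D₁ + D_h ≥ 0 reads ord F ≥ -B, and -B ≥ 0 inside the edges by the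
  -- choice of φ.
  set B : Γ.Point → ℝ := fun p => D₁ p - Γ.ord φ p with hB
  have hBinner : ∀ e, ∀ t ∈ Ioo 0 (Γ.len e), 0 ≤ -B (Γ.param e t) := by
    intro e t ht
    have := hordφ (Γ.param e t) (by rw [param_inner ht]; simp)
    simp only [hB]
    linarith
  obtain ⟨F, hF, hFv, hFmax⟩ := exists_greatest B v₀ (φ := φ)
    ⟨hφ, fun p => by simp only [hB]; linarith [hD₁pos p],
      fun e t ht => (hD₁pos _).trans (hordφ _ (by rw [param_inner ht]; simp))⟩
  have hrat := hf₀.add (hF.rational.sub hφ)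
  obtain ⟨P, hP⟩ := hrat.exists_divisor
  have hPord : ∀ p, (P p : ℝ) = Γ.ord f₀ p + (Γ.ord F p - Γ.ord φ p) := by
    intro p
    rw [hP, hf₀.ord_add (hF.rational.sub hφ), hF.rational.ord_sub hφ]
  have hval : ∀ p, p ≠ v₀ → (((D + P) p : ℤ) : ℝ) = B p + Γ.ord F p := by
    intro p hp
    rw [Finsupp.add_apply, Int.cast_add, hPord, hB]
    simp only [hD₁ne p hp]
    ring
  refine ⟨D + P, ⟨fun p hp => ?_, fun X hXc hX hv₀ => ?_⟩, _, hrat, fun p => ?_⟩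
  · have : (0 : ℝ) ≤ ((D + P) p : ℤ) := by
      rw [hval p hp]
      linarith [hF.le_ord p]
    exact_mod_cast this
  · by_contra hsat
    push Not at hsat
    obtain ⟨g, hg, hgv, hgX, hg0, hg1⟩ := exists_firing hXc hX.isPreconnected hv₀
    -- Firing lowers the order only on the boundary of X, by at most the number of leaving edges,
    -- which saturation covers. So F + g competes with the greatest function F, yet exceeds it on X.
    have hord : ∀ p, -B p ≤ Γ.ord (fun p => F p + g p) p := by
      intro p
      rw [hF.rational.ord_add hg]
      by_cases hp : p ∈ frontier X
      · have hpX := hXc.frontier_subset hp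
        have h2 : (Γ.leaving X p : ℝ) ≤ ((D + P) p : ℤ) := by exact_mod_cast hsat p hp
        rw [hval p (by rintro rfl; exact hv₀ hpX)] at h2
        linarith [hg1 p hpX]
      · linarith [hg0 p hp, hF.le_ord p]
    obtain ⟨x, hx⟩ := hX.nonempty
    have := hFmax _ ⟨hF.rational.add hg, hord, fun e t ht => (hBinner e t ht).trans (hord _)⟩
      (by rw [hgv, add_zero, hFv]) x
    linarith [hgX x hx]
  · rw [← hP, Finsupp.add_apply, Int.cast_add]

end MetricGraph

theorem mainTheorem2 {V : Type u} {E : Type v} [Finite V] [Fintype E] (Γ : MetricGraph V E)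
    (v₀ : Γ.Point) (D : Γ.Divisor) :
    ∃! D₀ : Γ.Divisor, Γ.IsReduced v₀ D₀ ∧ Γ.LinEquiv D₀ D := by
  obtain ⟨D₀, hred, heq⟩ := MetricGraph.exists_isReduced v₀ D
  exact ⟨D₀, ⟨hred, heq⟩, fun D' h => h.1.eq_of_linEquiv hred h.2 heq⟩
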